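/- Let $\mathbb H$ be the Poincaré half-plane with boundary at infinity $\partial_\infty\mathbb H=\mathbb R\cup\{\infty\}$, and for $o\in\mathbb H$ give $\partial_\infty\mathbb H$ the Gromov–Bourdon visual distance $\rho_o(\xi,\eta)=\lim_{z\to\xi,\,w\to\eta}e^{-\langle z,w\rangle_o}$ (where $\langle z,w\rangle_o=\frac12(d(z,o)+d(o,w)-d(z,w))$), with respect to which the Hausdorff dimension $\mathrm{HD}$ is taken. For a discrete group $\Gamma$ of isometries of $\mathbb H$ let $\Lambda_\Gamma\subset\partial_\infty\mathbb H$ be its limit set, i.e. the set of points at infinity in the closure of the orbit $\Gamma\cdot o$ in $\mathbb H\cup\partial_\infty\mathbb H$, and let $\Lambda^\tau_\Gamma$ be its transient limit set: the set of $\xi\in\Lambda_\Gamma$ with $\lim_{t\to\infty}d(\xi_t,\Gamma\cdot o)=\infty$, where $\xi_t$ is the point at distance $t$ from $o$ on the geodesic ray $[o,\xi)$. For $j\ge 1$ put $x_j=2^{j^2}$, $r_j=2^{-j-2}$, $x_j'=\sqrt{x_j^2+r_j^2}$, and let $C_{j}$ and $C_{-j}$ be the Euclidean half-circles in $\mathbb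 H$ of radius $r_j$ centred at $x'_j$ and $-x'_j$. **Theorem.** There is an infinitely generated, torsion-free Fuchsian group $\Gamma$ (a discrete group of orientation-preserving isometries of $\mathbb H$ that is not finitely generated and in which only the identity has finite order) such that $$\mathrm{HD}(\Lambda^\tau_\Gamma)=0$$ for every base point $o$. Moreover $\Gamma$ can be taken to be generated by hyperbolic isometries $h_j$, $j\ge1$, where $h_j$ has fixed points $-x_j$ and $x_j$ at infinity and maps $C_{-j}$ onto $C_j$ and the exterior of $C_{-j}$ onto the interior of $C_j$; and for every $k\ge 1$ and every base point $o$ the subgroup $\Gamma_k$ generated by the $h_j$ with $j\ge k$ satisfies $\mathrm{HD}(\Lambda_{\Gamma_k})\le \frac1{2k}$. -/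

import Mathlib

open UpperHalfPlane Filter Topology
open scoped MatrixGroups ComplexConjugate ENNReal Pointwise

namespace Fuchsian

noncomputable section

/-! ### Isometries of the hyperbolic plane -/

/-- The isometry of the Poincaré half-plane `ℍ` given by the Möbius transformation of a matrix in
`SL(2, ℝ)`, as a group homomorphism. -/
def moebius : SL(2, ℝ) →* (ℍ ≃ᵢ ℍ) where
  toFun g := IsometryEquiv.constSMul g
  map_one' := by
    ext z : 1
    exact one_smul SL(2, ℝ) z
  map_mul' g g' := by
    ext z : 1
    exact mul_smul g g' z

/-- The group of orientation-preserving isometries of `ℍ`: the real Möbius transformations of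
positive determinant. -/
def isomPlus : Subgroup (ℍ ≃ᵢ ℍ) := moebius.range

/-- The compact-open topology on the isometry group of `ℍ`. -/
instance isometryTopology : TopologicalSpace (ℍ ≃ᵢ ℍ) :=
  TopologicalSpace.induced (fun f => (⟨f, f.continuous⟩ : C(ℍ, ℍ))) inferInstance

/-- A Fuchsian group: a discrete group of orientation-preserving isometries of `ℍ`. -/
def IsFuchsian (Γ : Subgroup (ℍ ≃ᵢ ℍ)) : Prop :=
  Γ ≤ isomPlus ∧ DiscreteTopology Γ

/-- A group of isometries without nontrivial elements of finite order. -/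
def IsTorsionFree (Γ : Subgroup (ℍ ≃ᵢ ℍ)) : Prop :=
  ∀ γ ∈ Γ, IsOfFinOrder γ → γ = 1

/-! ### The boundary at infinity

The boundary at infinity of `ℍ` is `ℝ ∪ {∞}`, that is `OnePoint ℝ`. For a point `o` of `ℍ`, the
Cayley transform `z ↦ (z - o) / (z - conj o)` identifies `ℍ` together with its boundary at infinity
with the closed unit disc, `o` being sent to the centre. -/

/-- The Cayley transform from `ℍ` to the unit disc which sends `o` to `0`. -/
def discMap (o z : ℍ) : ℂ := ((z : ℂ) - o) / ((z : ℂ) - conj (o : ℂ))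

/-- The extension of the Cayley transform to the boundary at infinity, with values in the unit
circle. -/
def bdryMap (o : ℍ) : OnePoint ℝ → ℂ
  | none => 1
  | some x => ((x : ℂ) - o) / ((x : ℂ) - conj (o : ℂ))

/-- The filter of neighbourhoods in `ℍ` of a point `ξ` at infinity, for the topology of
the compactification of `ℍ` by its boundary at infinity (the closed disc). -/
def nhdsInfty (o : ℍ) (ξ : OnePoint ℝ) : Filter ℍ := comap (discMap o) (𝓝 (bdryMap o ξ))

/-- The Gromov product at `o`. -/
def gromovProduct (o z w : ℍ) : ℝ := (dist z o + dist o w - dist z w) / 2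

/-- The Gromov-Bourdon visual distance on the boundary seen from `o`. It is half of the chordal
distance in the disc model centred at `o`; that this is `exp (-⟨ξ, η⟩_o)`, the Gromov product being
extended to the boundary by taking limits, is `tendsto_exp_neg_gromovProduct`. -/
def visualDist (o : ℍ) (ξ η : OnePoint ℝ) : ℝ := ‖bdryMap o ξ - bdryMap o η‖ / 2

/-- Hausdorff dimension of a set of points at infinity, with respect to the visual distance seen
from `o`: `bdryMap o` multiplies the visual distance by `2` (see `visualDist`). -/
def hausdorffDim (o : ℍ) (S : Set (OnePoint ℝ)) : ℝ≥0∞ := dimH (bdryMap o '' S)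

/-! ### Limit sets -/

/-- The orbit of `o`. -/
def orbit (Γ : Subgroup (ℍ ≃ᵢ ℍ)) (o : ℍ) : Set ℍ := {z | ∃ γ ∈ Γ, γ o = z}

/-- The limit set: the points at infinity in the closure of the orbit of `o`, taken in the
compactification of `ℍ` by its boundary at infinity. -/
def limitSet (Γ : Subgroup (ℍ ≃ᵢ ℍ)) (o : ℍ) : Set (OnePoint ℝ) :=
  {ξ | bdryMap o ξ ∈ closure (discMap o '' orbit Γ o)}

/-- `c` restricted to `[0, ∞)` is the (unit speed) geodesic ray from `o` to `ξ`. -/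
structure IsGeodesicRay (o : ℍ) (ξ : OnePoint ℝ) (c : ℝ → ℍ) : Prop where
  dist_eq : ∀ s t : ℝ, 0 ≤ s → 0 ≤ t → dist (c s) (c t) = |s - t|
  start : c 0 = o
  tendsto : Tendsto c atTop (nhdsInfty o ξ)

/-- The transient limit set: the limit points `ξ` such that the distance from `ξ_t` to the orbit
of `o` tends to infinity with `t`, where `ξ_t` is the point at distance `t` from `o` on the geodesic
ray from `o` to `ξ`. -/
def transientLimitSet (Γ : Subgroup (ℍ ≃ᵢ ℍ)) (o : ℍ) : Set (OnePoint ℝ) :=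
  {ξ | ξ ∈ limitSet Γ o ∧ ∃ c : ℝ → ℍ, IsGeodesicRay o ξ c ∧
    Tendsto (fun t => Metric.infDist (c t) (orbit Γ o)) atTop atTop}

/-! ### The half-circles -/

/-- The Euclidean half-circle in `ℍ` with centre `a` on the real axis and radius `r`. -/
def halfCircle (a r : ℝ) : Set ℍ := {z | ‖(z : ℂ) - a‖ = r}

/-- The interior of the half-circle. -/
def halfDisc (a r : ℝ) : Set ℍ := {z | ‖(z : ℂ) - a‖ < r}

/-- The exterior of the half-circle. -/
def halfCircleExt (a r : ℝ) : Set ℍ := {z | r < ‖(z : ℂ) - a‖}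

/-- The positive fixed point `x_j = 2 ^ (j ^ 2)`. -/
def fixPt (j : ℕ) : ℝ := 2 ^ (j ^ 2)

/-- The radius `r_j = 2 ^ (- j - 2)`. -/
def radius (j : ℕ) : ℝ := (2 ^ (j + 2))⁻¹

/-- The centre `√(x_j ^ 2 + r_j ^ 2)` of `C_j`; the centre of `C_{-j}` is its opposite. -/
def centre (j : ℕ) : ℝ := √(fixPt j ^ 2 + radius j ^ 2)

/-- `g` is a hyperbolic Möbius transformation with fixed points `-x_j` and `x_j` at infinity, which
pairs `C_{-j}` with `C_j`: it maps `C_{-j}` onto `C_j` and the exterior of `C_{-j}` onto the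
interior of `C_j`. -/
structure PairsHalfCircles (j : ℕ) (g : SL(2, ℝ)) : Prop where
  fixed : {ξ : OnePoint ℝ | (g : GL (Fin 2) ℝ) • ξ = ξ} =
    {((-fixPt j : ℝ) : OnePoint ℝ), (fixPt j : OnePoint ℝ)}
  circle : moebius g '' halfCircle (-centre j) (radius j) = halfCircle (centre j) (radius j)
  ext_int : moebius g '' halfCircleExt (-centre j) (radius j) = halfDisc (centre j) (radius j)

/-- The group of isometries generated by the `h j` with `j ≥ k`. -/
def tailGroup (h : ℕ → SL(2, ℝ)) (k : ℕ) : Subgroup (ℍ ≃ᵢ ℍ) :=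
  Subgroup.closure {f | ∃ j, k ≤ j ∧ f = moebius (h j)}

/-! ### The visual distance and the Gromov product -/

theorem sub_conj_ne_zero (o z : ℍ) : (z : ℂ) - conj (o : ℂ) ≠ 0 := by
  intro h
  have h1 := congrArg Complex.im h
  have h2 := z.im_pos
  have h3 := o.im_pos
  simp at h1
  linarith

theorem norm_discMap (o z : ℍ) : ‖discMap o z‖ = Real.tanh (dist z o / 2) := by
  rw [UpperHalfPlane.tanh_half_dist, discMap, norm_div, Complex.dist_eq, Complex.dist_eq]

theorem norm_bdryMap (o : ℍ) (ξ : OnePoint ℝ) : ‖bdryMap o ξ‖ = 1 := by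
  cases ξ with
  | infty => simp [bdryMap]
  | coe x =>
    have e : ((x : ℂ) - conj (o : ℂ)) = conj ((x : ℂ) - o) := by simp
    have h : (x : ℂ) - o ≠ 0 := by
      intro h
      have h1 := congrArg Complex.im h
      have h3 := o.im_pos
      simp at h1
      linarith
    change ‖((x : ℂ) - o) / ((x : ℂ) - conj (o : ℂ))‖ = 1
    rw [norm_div, e, Complex.norm_conj, div_self (norm_ne_zero_iff.2 h)]

theorem sinh_half_dist_eq (o z w : ℍ) : Real.sinh (dist z w / 2) =
    ‖discMap o z - discMap o w‖ * Real.cosh (dist z o / 2) * Real.cosh (dist w o / 2) := by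
  have hz := sub_conj_ne_zero o z
  have hw := sub_conj_ne_zero o w
  have e : discMap o z - discMap o w = ((z : ℂ) - w) * ((o : ℂ) - conj (o : ℂ)) /
      (((z : ℂ) - conj (o : ℂ)) * ((w : ℂ) - conj (o : ℂ))) := by
    rw [discMap, discMap, div_sub_div _ _ hz hw]
    congr 1
    ring
  have ho : ‖(o : ℂ) - conj (o : ℂ)‖ = 2 * o.im := by
    rw [Complex.sub_conj, norm_mul, Complex.norm_I, Complex.norm_real, mul_one, Real.norm_eq_abs,
      abs_of_pos (by have := o.im_pos; simpa using this)]
    rfl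
  have hz' := norm_ne_zero_iff.2 hz
  have hw' := norm_ne_zero_iff.2 hw
  have p1 := Real.sqrt_pos.2 z.im_pos
  have p2 := Real.sqrt_pos.2 w.im_pos
  have p3 := Real.sqrt_pos.2 o.im_pos
  rw [UpperHalfPlane.sinh_half_dist, UpperHalfPlane.cosh_half_dist, UpperHalfPlane.cosh_half_dist,
    e, norm_div, norm_mul, norm_mul, ho, Complex.dist_eq, Complex.dist_eq, Complex.dist_eq,
    Real.sqrt_mul z.im_pos.le, Real.sqrt_mul z.im_pos.le, Real.sqrt_mul w.im_pos.le]
  have h4 : o.im = √o.im * √o.im := (Real.mul_self_sqrt o.im_pos.le).symm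
  generalize √o.im = s at *
  rw [h4]
  field_simp

theorem exp_neg_gromovProduct (o z w : ℍ) : Real.exp (-gromovProduct o z w) =
    ‖discMap o z - discMap o w‖ / 2 * (1 + Real.exp (-dist z o)) * (1 + Real.exp (-dist w o)) +
      Real.exp (-dist z w / 2) * Real.exp (-dist z o / 2) * Real.exp (-dist w o / 2) := by
  have h := sinh_half_dist_eq o z w
  rw [Real.sinh_eq, Real.cosh_eq, Real.cosh_eq] at h
  have e1 : Real.exp (-gromovProduct o z w) =
      Real.exp (dist z w / 2) * Real.exp (-(dist z o / 2)) * Real.exp (-(dist w o / 2)) := by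
    rw [← Real.exp_add, ← Real.exp_add, gromovProduct, dist_comm o w]
    congr 1
    ring
  have e2 (a : ℝ) : Real.exp (-a) = Real.exp (-(a / 2)) * Real.exp (-(a / 2)) := by
    rw [← Real.exp_add]
    congr 1
    ring
  have e3 (a : ℝ) : Real.exp (a / 2) * Real.exp (-(a / 2)) = 1 := by
    rw [← Real.exp_add, add_neg_cancel, Real.exp_zero]
  rw [e1, e2 (dist z o), e2 (dist w o), neg_div, neg_div, neg_div]
  have hz := e3 (dist z o)
  have hw := e3 (dist w o)
  generalize Real.exp (-(dist z o / 2)) = a at *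
  generalize Real.exp (-(dist w o / 2)) = b at *
  generalize Real.exp (dist z o / 2) = a' at *
  generalize Real.exp (dist w o / 2) = b' at *
  generalize Real.exp (dist z w / 2) = c at *
  generalize Real.exp (-(dist z w / 2)) = c' at *
  generalize ‖discMap o z - discMap o w‖ = n at *
  linear_combination (2 * a * b) * h + (n / 2 * (b' * b + b * b) + 0) * hz +
    (n / 2 * (1 + a * a)) * hw

theorem tendsto_exp_neg_dist (o : ℍ) (ξ : OnePoint ℝ) :
    Tendsto (fun z => Real.exp (-dist z o)) (nhdsInfty o ξ) (𝓝 0) := by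
  have h : ∀ z : ℍ, Real.exp (-dist z o) = (1 - ‖discMap o z‖) / (1 + ‖discMap o z‖) := by
    intro z
    have e2 (a : ℝ) : Real.exp (-a) = Real.exp (-(a / 2)) * Real.exp (-(a / 2)) := by
      rw [← Real.exp_add]
      congr 1
      ring
    have e3 : Real.exp (dist z o / 2) * Real.exp (-(dist z o / 2)) = 1 := by
      rw [← Real.exp_add, add_neg_cancel, Real.exp_zero]
    rw [norm_discMap, Real.tanh_eq_sinh_div_cosh, Real.sinh_eq, Real.cosh_eq, e2]
    have p1 := Real.exp_pos (dist z o / 2)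
    have p2 := Real.exp_pos (-(dist z o / 2))
    generalize Real.exp (dist z o / 2) = a at *
    generalize Real.exp (-(dist z o / 2)) = b at *
    have hb : b = a⁻¹ := eq_inv_of_mul_eq_one_right e3
    have q : (a - b) / 2 / ((a + b) / 2) = (a - b) / (a + b) := by field_simp
    have q1 : (1 - (a - b) / (a + b)) = 2 * b / (a + b) := by field_simp; ring
    have q2 : (1 + (a - b) / (a + b)) = 2 * a / (a + b) := by field_simp; ring
    rw [q, q1, q2, div_div_div_cancel_right₀ (by positivity), eq_div_iff (by positivity)]
    linear_combination (2 * b) * e3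
  simp_rw [h]
  have ht : Tendsto (fun z => ‖discMap o z‖) (nhdsInfty o ξ) (𝓝 1) := by
    rw [← norm_bdryMap o ξ]
    exact tendsto_comap.norm
  have := (ht.const_sub 1).div (ht.const_add 1) (by norm_num)
  rw [sub_self, zero_div] at this
  exact this

/-- The visual distance is the limit of `exp (-⟨z, w⟩_o)` as `z → ξ` and `w → η`. -/
theorem tendsto_exp_neg_gromovProduct (o : ℍ) (ξ η : OnePoint ℝ) :
    Tendsto (fun p : ℍ × ℍ => Real.exp (-gromovProduct o p.1 p.2))
      (nhdsInfty o ξ ×ˢ nhdsInfty o η) (𝓝 (visualDist o ξ η)) := by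
  simp_rw [exp_neg_gromovProduct]
  have h1 : Tendsto (fun p : ℍ × ℍ => Real.exp (-dist p.1 o)) (nhdsInfty o ξ ×ˢ nhdsInfty o η)
      (𝓝 0) := (tendsto_exp_neg_dist o ξ).comp tendsto_fst
  have h2 : Tendsto (fun p : ℍ × ℍ => Real.exp (-dist p.2 o)) (nhdsInfty o ξ ×ˢ nhdsInfty o η)
      (𝓝 0) := (tendsto_exp_neg_dist o η).comp tendsto_snd
  have h3 : Tendsto (fun p : ℍ × ℍ => ‖discMap o p.1 - discMap o p.2‖)
      (nhdsInfty o ξ ×ˢ nhdsInfty o η) (𝓝 ‖bdryMap o ξ - bdryMap o η‖) :=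
    ((tendsto_comap.comp tendsto_fst).sub (tendsto_comap.comp tendsto_snd)).norm
  have h4 : Tendsto (fun p : ℍ × ℍ => Real.exp (-dist p.1 p.2 / 2) * Real.exp (-dist p.1 o / 2) *
      Real.exp (-dist p.2 o / 2)) (nhdsInfty o ξ ×ˢ nhdsInfty o η) (𝓝 0) := by
    refine squeeze_zero (fun p => by positivity) (fun p => ?_) h1
    rw [← Real.exp_add, ← Real.exp_add]
    apply Real.exp_le_exp.2
    have := dist_triangle p.1 p.2 o
    linarith
  have := (((h3.div_const 2).mul (h1.const_add 1)).mul (h2.const_add 1)).add h4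
  simpa [visualDist] using this

end

end Fuchsian

namespace Fuchsian

noncomputable section

/-! ### The numbers -/

/-! The discs bounded by the half-circles have radius at most 1/4, while their centres grow so fast
that any two discs lie at a distance comparable to the larger centre. A generator or its inverse (a
"letter") sends every disc except that of its inverse into its own disc. By ping-pong
(`norm_letterMap_sub_lt_of_adj`) the letters generate a free group (`lift_moebius_injective`), hence
one that is torsion-free and not finitely generated. It is discrete because a nontrivial reduced
word moves `I` into a disc, away from `I`.

A real limit point outside a countable set (the orbit of `∞`) is coded by an infinite reduced word
(`exists_isCoding`): strip one letter after another. On the discs that may follow it, a letter of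
index `j` contracts by `(4 r_j / c_j)²`, where `c_j` is the centre, and this is at most
`2^(-2j(j+1))`. For `j ≥ k` the power `1/(2k)` of this ratio is at most `2^(-(j+1))`
(`ratio_rpow_le`). Summed over `j ≥ k` and both signs this is at most 1, so covering by cylinders
(`dimH_iUnion_le_of_contractions`) gives dimension at most `1/(2k)` for the limit set of the `k`-th
tail group.

For the transient limit set, suppose that a letter of index less than `k` occurs in the code of `ξ`,
and let `γ` be the prefix ending with it. Seen from `γ I`, the point `I` lies in the disc of the
inverse letter, and the far part of the ray in the disc of the next letter. These discs are apart,
so the Gromov product at `γ I` is bounded in terms of `k` alone (`exp_neg_gromovProduct_ge`), and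
the ray passes near `γ I` (`exists_dist_le_of_gromovProduct_le`). If this happens infinitely often,
the ray keeps returning near the orbit. Hence the code of a transient point has only finitely many
letters of index less than `k` (`IsCoding.eventually_le`). Up to a countable set, transient points
thus lie in countably many Lipschitz images of points coded by letters of index at least `k`. The
dimension is at most `1/(2k)` for every `k`, hence 0. -/

theorem one_le_fixPt (j : ℕ) : 1 ≤ fixPt j := one_le_pow₀ (by norm_num)

theorem radius_pos (j : ℕ) : 0 < radius j := by unfold radius; positivity

theorem radius_le (j : ℕ) : radius j ≤ 1 / 4 := by
  have h : (1 : ℝ) ≤ 2 ^ j := one_le_pow₀ (by norm_num)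
  rw [radius, pow_add, inv_le_comm₀ (by positivity) (by norm_num)]
  norm_num
  linarith

theorem centre_sq (j : ℕ) : centre j ^ 2 = fixPt j ^ 2 + radius j ^ 2 :=
  Real.sq_sqrt (by positivity)

theorem fixPt_lt_centre (j : ℕ) : fixPt j < centre j :=
  Real.lt_sqrt_of_sq_lt (by have := radius_pos j; nlinarith)

theorem one_lt_centre (j : ℕ) : 1 < centre j := (one_le_fixPt j).trans_lt (fixPt_lt_centre j)

theorem centre_pos (j : ℕ) : 0 < centre j := one_pos.trans (one_lt_centre j)

theorem centre_le_fixPt_add (j : ℕ) : centre j ≤ fixPt j + 1 / 32 := by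
  apply Real.sqrt_le_iff.2
  have h1 := one_le_fixPt j
  have h2 := radius_le j
  have h3 := radius_pos j
  constructor <;> nlinarith

theorem two_mul_fixPt_le {i j : ℕ} (h : i < j) : 2 * fixPt i ≤ fixPt j := by
  rw [fixPt, fixPt, ← pow_succ']
  exact pow_le_pow_right₀ (by norm_num) (by nlinarith)

theorem centre_le_of_lt {i j : ℕ} (h : i < j) : centre i ≤ 5 / 8 * centre j := by
  have h1 := centre_le_fixPt_add i
  have h2 := two_mul_fixPt_le h
  have h3 := fixPt_lt_centre j
  have h4 := one_le_fixPt i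
  linarith

theorem centre_mono {i j : ℕ} (h : i ≤ j) : centre i ≤ centre j := by
  rcases h.eq_or_lt with rfl | h
  · rfl
  · have := centre_le_of_lt h
    have := centre_pos j
    linarith

theorem self_le_centre (j : ℕ) : (j : ℝ) ≤ centre j := by
  refine le_trans ?_ (fixPt_lt_centre j).le
  have h : j ≤ 2 ^ (j ^ 2) := by
    have := Nat.lt_two_pow_self (n := j ^ 2)
    nlinarith
  rw [fixPt]
  exact_mod_cast h

/-! ### The generators -/

/-- The matrix of `z ↦ c_j - r_j ^ 2 / (z + c_j)`. -/
def pairingMatrix (j : ℕ) : SL(2, ℝ) :=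
  ⟨(radius j)⁻¹ • !![centre j, fixPt j ^ 2; 1, centre j], by
    have h := centre_sq j
    have h2 := (radius_pos j).ne'
    rw [Matrix.det_smul, Matrix.det_fin_two_of, Fintype.card_fin]
    field_simp
    linarith⟩

/-- The Euclidean centre of the half-circle of a letter. -/
def letterCentre (a : ℕ × Bool) : ℝ := cond a.2 (centre a.1) (-centre a.1)

/-- The letter of the inverse of a generator. -/
def invLetter (a : ℕ × Bool) : ℕ × Bool := (a.1, !a.2)

/-- The Möbius transformation of a letter, on the complex plane. -/
def letterMap (a : ℕ × Bool) (z : ℂ) : ℂ := letterCentre a - radius a.1 ^ 2 / (z + letterCentre a)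

/-- The isometry of a letter. -/
def letterIsom (a : ℕ × Bool) : ℍ ≃ᵢ ℍ :=
  cond a.2 (moebius (pairingMatrix a.1)) (moebius (pairingMatrix a.1))⁻¹

@[simp] theorem letterCentre_invLetter (a : ℕ × Bool) :
    letterCentre (invLetter a) = -letterCentre a := by
  rcases a with ⟨j, _ | _⟩ <;> simp [letterCentre, invLetter]

@[simp] theorem invLetter_fst (a : ℕ × Bool) : (invLetter a).1 = a.1 := rfl

@[simp] theorem invLetter_invLetter (a : ℕ × Bool) : invLetter (invLetter a) = a := by
  simp [invLetter]

theorem letterIsom_invLetter (a : ℕ × Bool) : letterIsom (invLetter a) = (letterIsom a)⁻¹ := by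
  rcases a with ⟨j, _ | _⟩ <;> simp [letterIsom, invLetter]

theorem abs_letterCentre (a : ℕ × Bool) : |letterCentre a| = centre a.1 := by
  rcases a with ⟨j, _ | _⟩ <;> simp [letterCentre, abs_of_pos (centre_pos j)]

theorem coe_sub_ofReal_ne_zero (z : ℍ) (x : ℝ) : (z : ℂ) - x ≠ 0 := by
  intro h
  have := congrArg Complex.im h
  have := z.im_pos
  simp at *
  linarith

theorem coe_add_ofReal_ne_zero (z : ℍ) (x : ℝ) : (z : ℂ) + x ≠ 0 := by
  have := coe_sub_ofReal_ne_zero z (-x)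
  simpa using this

theorem coe_moebius_pairingMatrix (j : ℕ) (z : ℍ) :
    ((moebius (pairingMatrix j) z : ℍ) : ℂ) = letterMap (j, true) z := by
  have h1 : moebius (pairingMatrix j) z = pairingMatrix j • z := rfl
  have h2 := coe_add_ofReal_ne_zero z (centre j)
  have h3 : (radius j : ℂ) ≠ 0 := by exact_mod_cast (radius_pos j).ne'
  have h4 : (centre j : ℂ) ^ 2 = fixPt j ^ 2 + radius j ^ 2 := by exact_mod_cast centre_sq j
  rw [h1, UpperHalfPlane.coe_specialLinearGroup_apply]
  simp [pairingMatrix, letterMap, letterCentre]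
  field_simp
  linear_combination (-1 : ℂ) * h4

/-- With `c` the centre and `r` the radius, the relation `w = c - r² / (z + c)` reads `(w - c) (z +
c) = -r²`. Solving for `z` replaces `c` by `-c`, so one formula serves a generator and its inverse.
The excluded point is the pole of the inverse. -/
theorem letterMap_letterMap_invLetter (a : ℕ × Bool) {z : ℂ} (hz : z ≠ letterCentre a) :
    letterMap a (letterMap (invLetter a) z) = z := by
  have h2 := sub_ne_zero.2 hz
  have h3 : (radius a.1 : ℂ) ≠ 0 := by exact_mod_cast (radius_pos a.1).ne'
  simp only [letterMap, letterCentre_invLetter, invLetter_fst, Complex.ofReal_neg,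
    ← sub_eq_add_neg]
  have h5 : -(letterCentre a : ℂ) - radius a.1 ^ 2 / (z - letterCentre a) + letterCentre a =
    - (radius a.1 ^ 2 / (z - letterCentre a)) := by ring
  rw [h5]
  field_simp
  ring

theorem coe_letterIsom (a : ℕ × Bool) (z : ℍ) : ((letterIsom a z : ℍ) : ℂ) = letterMap a z := by
  rcases a with ⟨j, _ | _⟩
  · obtain ⟨w, rfl⟩ := (moebius (pairingMatrix j)).surjective z
    have h : letterIsom (j, false) (moebius (pairingMatrix j) w) = w :=
      (moebius (pairingMatrix j)).symm_apply_apply w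
    rw [h, coe_moebius_pairingMatrix]
    exact (letterMap_letterMap_invLetter (j, false)
      (by simpa using sub_ne_zero.1 (coe_sub_ofReal_ne_zero w _))).symm
  · exact coe_moebius_pairingMatrix j z

theorem norm_letterMap_sub (a : ℕ × Bool) (z : ℂ) :
    ‖letterMap a z - letterCentre a‖ = radius a.1 ^ 2 / ‖z + letterCentre a‖ := by
  rw [letterMap, sub_sub_cancel_left, norm_neg, norm_div, norm_pow, Complex.norm_real,
    Real.norm_of_nonneg (radius_pos _).le]

theorem letterMap_sub_letterMap (a : ℕ × Bool) {z w : ℂ} (hz : z + letterCentre a ≠ 0)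
    (hw : w + letterCentre a ≠ 0) : letterMap a z - letterMap a w =
      radius a.1 ^ 2 * (z - w) / ((z + letterCentre a) * (w + letterCentre a)) := by
  simp only [letterMap]
  field_simp
  ring

/-- The relation between consecutive letters of a reduced word. -/
def Adj (a b : ℕ × Bool) : Prop := a.1 = b.1 → a.2 = b.2

theorem Adj.invLetter {a b : ℕ × Bool} (h : Adj a b) : Adj (invLetter b) (invLetter a) := by
  intro e
  have := h e.symm
  simp [Fuchsian.invLetter, this]

/-- Distinct discs are well separated. -/
theorem le_norm_add_letterCentre {a b : ℕ × Bool} (hab : Adj a b) {z : ℂ}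
    (hz : ‖z - letterCentre b‖ ≤ radius b.1) :
    max (centre a.1) (centre b.1) / 4 ≤ ‖z + letterCentre a‖ := by
  have h1 : |letterCentre b + letterCentre a| ≤ ‖z + letterCentre a‖ + ‖z - letterCentre b‖ := by
    rw [← Real.norm_eq_abs, ← Complex.norm_real]
    calc _ = ‖(z + letterCentre a) - (z - letterCentre b)‖ := by push_cast; congr 1; ring
      _ ≤ _ := norm_sub_le _ _
  have ra := radius_le b.1
  have ca := one_lt_centre a.1
  have cb := one_lt_centre b.1
  -- The left side of `≤` includes the radius to pass from the centre of the disc to its points. For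
  -- different indices the gap is at least 3/8 of the larger centre, which is at least 2, so a
  -- quarter remains after removing a radius of at most 1/4. For equal indices adjacency forces
  -- equal letters, and the gap is twice the centre.
  have key : max (centre a.1) (centre b.1) / 4 + radius b.1 ≤ |letterCentre b + letterCentre a| := by
    rcases lt_trichotomy a.1 b.1 with h | h | h
    · have h2 := centre_le_of_lt h
      have h3 : |letterCentre b| ≤ |letterCentre b + letterCentre a| + |letterCentre a| := by
        simpa using abs_sub (letterCentre b + letterCentre a) (letterCentre a)
      have h4 : 2 ≤ centre b.1 := by
        have := fixPt_lt_centre b.1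
        have := two_mul_fixPt_le h
        have := one_le_fixPt a.1
        linarith
      rw [abs_letterCentre, abs_letterCentre] at h3
      rw [max_eq_right (by linarith)]
      linarith
    · have h2 : letterCentre b = letterCentre a := by
        have : a = b := Prod.ext h (hab h)
        rw [this]
      rw [h2, ← h, max_self, ← two_mul, abs_mul, abs_letterCentre, abs_two]
      rw [← h] at ra
      linarith
    · have h2 := centre_le_of_lt h
      have h3 : |letterCentre a| ≤ |letterCentre b + letterCentre a| + |letterCentre b| := by
        simpa using abs_sub (letterCentre b + letterCentre a) (letterCentre b)
      have h4 : 2 ≤ centre a.1 := by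
        have := fixPt_lt_centre a.1
        have := two_mul_fixPt_le h
        have := one_le_fixPt b.1
        linarith
      rw [abs_letterCentre, abs_letterCentre] at h3
      rw [max_eq_left (by linarith)]
      linarith
  linarith

theorem centre_div_four_le {a b : ℕ × Bool} (hab : Adj a b) {z : ℂ}
    (hz : ‖z - letterCentre b‖ ≤ radius b.1) : centre a.1 / 4 ≤ ‖z + letterCentre a‖ :=
  (div_le_div_of_nonneg_right (le_max_left _ _) (by norm_num)).trans
    (le_norm_add_letterCentre hab hz)

theorem add_letterCentre_ne_zero {a b : ℕ × Bool} (hab : Adj a b) {z : ℂ}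
    (hz : ‖z - letterCentre b‖ ≤ radius b.1) : z + letterCentre a ≠ 0 := by
  rw [← norm_pos_iff]
  have := centre_div_four_le hab hz
  have := centre_pos a.1
  linarith

/-- The contraction ratio of a letter. -/
def ratio (j : ℕ) : ℝ := (4 * radius j / centre j) ^ 2

theorem ratio_nonneg (j : ℕ) : 0 ≤ ratio j := sq_nonneg _

/-- Equality holds at `j = 0`, where the fixed point is 1 and the radius is 1/4. A uniform bound
below 1 makes cylinders shrink geometrically. -/
theorem ratio_le (j : ℕ) : ratio j ≤ 16 / 17 := by
  have h1 := centre_sq j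
  have h2 := one_le_fixPt j
  have h3 := radius_le j
  have h4 := radius_pos j
  rw [ratio, div_pow, div_le_div_iff₀ (pow_pos (centre_pos j) 2) (by norm_num)]
  nlinarith

/-- A letter is a contraction on the discs which may follow it. -/
theorem norm_letterMap_sub_letterMap_le {a b b' : ℕ × Bool} (hab : Adj a b) (hab' : Adj a b')
    {z w : ℂ} (hz : ‖z - letterCentre b‖ ≤ radius b.1) (hw : ‖w - letterCentre b'‖ ≤ radius b'.1) :
    ‖letterMap a z - letterMap a w‖ ≤ ratio a.1 * ‖z - w‖ := by
  have h1 := centre_div_four_le hab hz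
  have h2 := centre_div_four_le hab' hw
  have h3 := centre_pos a.1
  have h4 := radius_pos a.1
  rw [letterMap_sub_letterMap a (add_letterCentre_ne_zero hab hz)
    (add_letterCentre_ne_zero hab' hw), norm_div, norm_mul, norm_mul, norm_pow, Complex.norm_real,
    Real.norm_of_nonneg h4.le, ratio, div_le_iff₀ (mul_pos (by linarith) (by linarith))]
  have h5 : (centre a.1 / 4) * (centre a.1 / 4) ≤
    ‖z + letterCentre a‖ * ‖w + letterCentre a‖ := by gcongr
  calc radius a.1 ^ 2 * ‖z - w‖
      = (4 * radius a.1 / centre a.1) ^ 2 * ‖z - w‖ * ((centre a.1 / 4) * (centre a.1 / 4)) := by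
        field_simp
    _ ≤ _ := by gcongr

/-- The ping-pong step: by `norm_letterMap_sub` it suffices that `z` is farther than the radius from
the centre of the inverse letter, and it is at least a quarter of a number above 1 away. -/
theorem norm_letterMap_sub_lt_of_adj {a b : ℕ × Bool} (hab : Adj a b) {z : ℂ}
    (hz : ‖z - letterCentre b‖ ≤ radius b.1) :
    ‖letterMap a z - letterCentre a‖ < radius a.1 := by
  have h1 := centre_div_four_le hab hz
  have h2 := one_lt_centre a.1
  have h3 := radius_le a.1
  have h4 := radius_pos a.1
  rw [norm_letterMap_sub, div_lt_iff₀ (by linarith)]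
  nlinarith

theorem norm_letterMap_I_sub_lt (a : ℕ × Bool) :
    ‖letterMap a Complex.I - letterCentre a‖ < radius a.1 := by
  have h1 : |(Complex.I + letterCentre a).re| ≤ _ := Complex.abs_re_le_norm _
  have h2 := one_lt_centre a.1
  have h3 := radius_le a.1
  have h4 := radius_pos a.1
  rw [Complex.add_re, Complex.I_re, zero_add, Complex.ofReal_re, abs_letterCentre] at h1
  rw [norm_letterMap_sub, div_lt_iff₀ (by linarith)]
  nlinarith

/-! ### Words -/

/-- The isometry of a word. -/
def wordIsom (L : List (ℕ × Bool)) : ℍ ≃ᵢ ℍ := (L.map letterIsom).prod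

@[simp] theorem wordIsom_nil : wordIsom [] = 1 := rfl

@[simp] theorem wordIsom_cons (a : ℕ × Bool) (L : List (ℕ × Bool)) :
    wordIsom (a :: L) = letterIsom a * wordIsom L := by simp [wordIsom]

theorem lift_moebius_mk (L : List (ℕ × Bool)) :
    FreeGroup.lift (fun j => moebius (pairingMatrix j)) (FreeGroup.mk L) = wordIsom L :=
  FreeGroup.lift_mk

theorem coe_wordIsom_cons (a : ℕ × Bool) (L : List (ℕ × Bool)) (z : ℍ) :
    ((wordIsom (a :: L) z : ℍ) : ℂ) = letterMap a (wordIsom L z : ℍ) := by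
  rw [wordIsom_cons, ← coe_letterIsom]
  rfl

/-- Ping-pong: a nontrivial reduced word maps `I` into the disc of its first letter. -/
theorem norm_wordIsom_I_sub_lt {a : ℕ × Bool} {L : List (ℕ × Bool)}
    (h : FreeGroup.IsReduced (a :: L)) :
    ‖((wordIsom (a :: L) I : ℍ) : ℂ) - letterCentre a‖ < radius a.1 := by
  induction L generalizing a with
  | nil =>
    rw [coe_wordIsom_cons]
    simpa using norm_letterMap_I_sub_lt a
  | cons b L ih =>
    rw [FreeGroup.isReduced_cons_cons] at h
    rw [coe_wordIsom_cons]
    exact norm_letterMap_sub_lt_of_adj h.1 (ih h.2).le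

theorem one_half_le_norm_wordIsom_I_sub {L : List (ℕ × Bool)} (h : FreeGroup.IsReduced L)
    (h0 : L ≠ []) : 1 / 2 ≤ ‖((wordIsom L I : ℍ) : ℂ) - Complex.I‖ := by
  rcases L with _ | ⟨a, L⟩
  · exact absurd rfl h0
  · have h1 := norm_wordIsom_I_sub_lt h
    have h2 := radius_le a.1
    have h3 : |(Complex.I - letterCentre a).im| ≤ _ := Complex.abs_im_le_norm _
    have h4 : ‖Complex.I - letterCentre a‖ ≤
        ‖((wordIsom (a :: L) I : ℍ) : ℂ) - letterCentre a‖ +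
          ‖((wordIsom (a :: L) I : ℍ) : ℂ) - Complex.I‖ := by
      refine le_trans (le_of_eq ?_) (norm_sub_le _ _)
      congr 1
      ring
    simp at h3
    linarith

theorem wordIsom_ne_one {L : List (ℕ × Bool)} (h : FreeGroup.IsReduced L) (h0 : L ≠ []) :
    wordIsom L ≠ 1 := by
  intro e
  have := one_half_le_norm_wordIsom_I_sub h h0
  rw [e] at this
  norm_num at this

theorem lift_moebius_injective :
    Function.Injective (FreeGroup.lift (fun j => moebius (pairingMatrix j))) := by
  rw [injective_iff_map_eq_one]
  intro x hx
  by_contra h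
  rw [← FreeGroup.mk_toWord (x := x), lift_moebius_mk] at hx
  exact wordIsom_ne_one FreeGroup.isReduced_toWord (by simpa using h) hx

theorem wordIsom_reduce (L : List (ℕ × Bool)) : wordIsom (FreeGroup.reduce L) = wordIsom L := by
  rw [← lift_moebius_mk, ← lift_moebius_mk, FreeGroup.reduce.self]

theorem letterIsom_mem_tailGroup {k : ℕ} {a : ℕ × Bool} (ha : k ≤ a.1) :
    letterIsom a ∈ tailGroup pairingMatrix k := by
  have h : moebius (pairingMatrix a.1) ∈ tailGroup pairingMatrix k :=
    Subgroup.subset_closure ⟨a.1, ha, rfl⟩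
  rcases a with ⟨j, _ | _⟩
  · exact inv_mem h
  · exact h

theorem wordIsom_append (L L' : List (ℕ × Bool)) :
    wordIsom (L ++ L') = wordIsom L * wordIsom L' := by simp [wordIsom]

theorem wordIsom_map_invLetter_reverse (L : List (ℕ × Bool)) :
    wordIsom (L.map invLetter).reverse = (wordIsom L)⁻¹ := by
  induction L with
  | nil => simp
  | cons a L ih => simp [wordIsom_append, ih, letterIsom_invLetter]

/-- Reducing a word only deletes letters, so the lower bound on the indices survives. -/
theorem exists_reduced_word {k : ℕ} {f : ℍ ≃ᵢ ℍ} (hf : f ∈ tailGroup pairingMatrix k) :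
    ∃ L : List (ℕ × Bool), FreeGroup.IsReduced L ∧ (∀ a ∈ L, k ≤ a.1) ∧ wordIsom L = f := by
  suffices h : ∃ L : List (ℕ × Bool), (∀ a ∈ L, k ≤ a.1) ∧ wordIsom L = f by
    obtain ⟨L, hL, rfl⟩ := h
    refine ⟨FreeGroup.reduce L, ?_, fun a ha => hL a ?_, wordIsom_reduce L⟩
    · rw [FreeGroup.isReduced_iff_reduce_eq, FreeGroup.reduce.idem]
    · exact (FreeGroup.Red.sublist FreeGroup.reduce.red).subset ha
  induction hf using Subgroup.closure_induction with
  | mem x hx =>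
    obtain ⟨j, hj, rfl⟩ := hx
    exact ⟨[(j, true)], by simpa using hj, by simp [letterIsom]⟩
  | one => exact ⟨[], by simp, rfl⟩
  | mul x y _ _ hx hy =>
    obtain ⟨L, hL, rfl⟩ := hx
    obtain ⟨L', hL', rfl⟩ := hy
    refine ⟨L ++ L', fun a ha => ?_, wordIsom_append L L'⟩
    rcases List.mem_append.1 ha with h | h
    exacts [hL a h, hL' a h]
  | inv x _ hx =>
    obtain ⟨L, hL, rfl⟩ := hx
    refine ⟨_, fun a ha => ?_, wordIsom_map_invLetter_reverse L⟩
    simp only [List.mem_reverse, List.mem_map] at ha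
    obtain ⟨b, hb, rfl⟩ := ha
    exact hL b hb

/-! ### The group -/

theorem tailGroup_le_isomPlus (h : ℕ → SL(2, ℝ)) (k : ℕ) : tailGroup h k ≤ isomPlus := by
  refine (Subgroup.closure_le _).2 ?_
  rintro _ ⟨j, -, rfl⟩
  exact ⟨h j, rfl⟩

theorem continuous_isometry_apply (z : ℍ) : Continuous fun f : ℍ ≃ᵢ ℍ => f z :=
  (continuous_eval_const (F := C(ℍ, ℍ)) z).comp
    (continuous_induced_dom (f := fun f : ℍ ≃ᵢ ℍ => (⟨f, f.continuous⟩ : C(ℍ, ℍ))))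

/-- A group of isometries is discrete if it moves some point by a definite amount. -/
theorem discreteTopology_of_forall_notMem {Γ : Subgroup (ℍ ≃ᵢ ℍ)} {z : ℍ} {U : Set ℍ}
    (hU : IsOpen U) (hz : z ∈ U) (h : ∀ γ ∈ Γ, γ z ∈ U → γ = 1) : DiscreteTopology Γ := by
  rw [discreteTopology_iff_isOpen_singleton]
  intro γ
  -- If `g z` lies in `γ U`, then `γ⁻¹ g` moves `z` within `U` and is trivial. So a singleton is the
  -- preimage of an open set under the continuous evaluation at `z`.
  have : ({γ} : Set Γ) = (fun g : Γ => (g : ℍ ≃ᵢ ℍ) z) ⁻¹' ((γ : ℍ ≃ᵢ ℍ) '' U) := by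
    ext g
    constructor
    · rintro rfl
      exact ⟨z, hz, rfl⟩
    · rintro ⟨w, hw, e⟩
      have h1 := h ((γ : ℍ ≃ᵢ ℍ)⁻¹ * g) (mul_mem (inv_mem γ.2) g.2)
      have h2 : ((γ : ℍ ≃ᵢ ℍ)⁻¹ * g) z = w := by
        change (γ : ℍ ≃ᵢ ℍ).symm ((g : ℍ ≃ᵢ ℍ) z) = w
        exact (γ : ℍ ≃ᵢ ℍ).symm_apply_eq.2 e.symm
      rw [h2] at h1
      exact (Subtype.ext (inv_mul_eq_one.1 (h1 hw))).symm
  rw [this]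
  exact ((γ : ℍ ≃ᵢ ℍ).toHomeomorph.isOpenMap U hU).preimage
    ((continuous_isometry_apply z).comp continuous_subtype_val)

theorem isFuchsian_tailGroup (k : ℕ) : IsFuchsian (tailGroup pairingMatrix k) := by
  refine ⟨tailGroup_le_isomPlus _ _, discreteTopology_of_forall_notMem
    (U := {z : ℍ | ‖(z : ℂ) - Complex.I‖ < 1 / 2}) (z := I) ?_ (by simp) fun γ hγ hU => ?_⟩
  · exact isOpen_lt (by fun_prop) continuous_const
  · obtain ⟨L, hL, -, rfl⟩ := exists_reduced_word hγ
    by_contra h0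
    have := one_half_le_norm_wordIsom_I_sub hL (by rintro rfl; exact h0 rfl)
    exact absurd hU (not_lt.2 this)

theorem isTorsionFree_tailGroup (k : ℕ) : IsTorsionFree (tailGroup pairingMatrix k) := by
  intro γ hγ hfin
  obtain ⟨L, -, -, rfl⟩ := exists_reduced_word hγ
  rw [← lift_moebius_mk] at hfin ⊢
  obtain ⟨n, hn, h⟩ := isOfFinOrder_iff_pow_eq_one.1 hfin
  rw [← map_pow] at h
  have := lift_moebius_injective (h.trans (map_one _).symm)
  rw [pow_eq_one_iff_left hn.ne'] at this
  rw [this, map_one]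

/-- The free group maps onto the free abelian group of the same rank, which would then be a finite
`ℤ`-module. -/
theorem not_fg_freeGroup (α : Type*) [Infinite α] : ¬ Group.FG (FreeGroup α) := by
  intro h
  have h1 : Group.FG (Multiplicative (α →₀ ℤ)) := by
    refine Group.fg_of_surjective (f := FreeGroup.lift fun a : α =>
      Multiplicative.ofAdd (Finsupp.single a (1 : ℤ))) ?_
    rw [← MonoidHom.range_eq_top, FreeGroup.range_lift_eq_closure, eq_top_iff]
    intro x _
    have key (y : α →₀ ℤ) : Multiplicative.ofAdd y ∈ Subgroup.closure
        (Set.range fun a : α => Multiplicative.ofAdd (Finsupp.single a (1 : ℤ))) := by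
      induction y using Finsupp.induction_linear with
      | zero => exact one_mem _
      | add f g hf hg => exact mul_mem hf hg
      | single a n =>
        have : Finsupp.single a n = n • Finsupp.single a (1 : ℤ) := by simp
        rw [this, ofAdd_zsmul]
        exact zpow_mem (Subgroup.subset_closure (Set.mem_range_self a)) n
    exact key x.toAdd
  rw [← AddGroup.fg_iff_mul_fg, ← Module.Finite.iff_addGroup_fg,
    Module.finite_finsupp_self_iff] at h1
  rcases h1 with h1 | h1
  · exact absurd (h1.elim 0 1) (by norm_num)
  · exact not_finite α

theorem not_fg_tailGroup (k : ℕ) : ¬ (tailGroup pairingMatrix k).FG := by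
  intro h
  have e : ((FreeGroup.lift (fun j => moebius (pairingMatrix j))).comp
      (FreeGroup.map (fun m => k + m))).range = tailGroup pairingMatrix k := by
    have : (FreeGroup.lift (fun j => moebius (pairingMatrix j))).comp
        (FreeGroup.map (fun m => k + m)) =
        FreeGroup.lift fun m => moebius (pairingMatrix (k + m)) := by ext; simp
    rw [this, FreeGroup.range_lift_eq_closure, tailGroup]
    congr 1
    ext f
    constructor
    · rintro ⟨m, rfl⟩
      exact ⟨k + m, by simp, rfl⟩
    · rintro ⟨j, hj, rfl⟩
      exact ⟨j - k, by simp [Nat.add_sub_cancel' hj]⟩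
  have inj : Function.Injective ((FreeGroup.lift (fun j => moebius (pairingMatrix j))).comp
      (FreeGroup.map (fun m => k + m))) :=
    lift_moebius_injective.comp (FreeGroup.map_injective (add_right_injective k))
  rw [← e, ← Group.fg_iff_subgroup_fg] at h
  exact not_fg_freeGroup ℕ (Group.fg_of_surjective
    (f := (MonoidHom.ofInjective inj).symm.toMonoidHom) (MonoidHom.ofInjective inj).symm.surjective)

/-! ### The pairing of the half-circles -/

theorem norm_coe_moebius_sub_centre (j : ℕ) (z : ℍ) :
    ‖((moebius (pairingMatrix j) z : ℍ) : ℂ) - centre j‖ =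
      radius j ^ 2 / ‖(z : ℂ) - (-centre j : ℝ)‖ := by
  rw [coe_moebius_pairingMatrix]
  simpa [letterCentre] using norm_letterMap_sub (j, true) z

theorem image_moebius_eq {j : ℕ} {S T : Set ℍ}
    (h : ∀ z, z ∈ S ↔ moebius (pairingMatrix j) z ∈ T) : moebius (pairingMatrix j) '' S = T := by
  have : S = moebius (pairingMatrix j) ⁻¹' T := Set.ext h
  rw [this, Set.image_preimage_eq _ (moebius (pairingMatrix j)).surjective]

theorem pairsHalfCircles_pairingMatrix (j : ℕ) : PairsHalfCircles j (pairingMatrix j) where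
  fixed := by
    have hr := (radius_pos j).ne'
    have hc := centre_sq j
    have hx := fixPt_lt_centre j
    have hx1 := one_le_fixPt j
    have h10 : ((pairingMatrix j : SL(2, ℝ)) : GL (Fin 2) ℝ) 1 0 = (radius j)⁻¹ := by
      change ((radius j)⁻¹ • !![centre j, fixPt j ^ 2; 1, centre j]) 1 0 = _
      simp
    have h00 : ((pairingMatrix j : SL(2, ℝ)) : GL (Fin 2) ℝ) 0 0 = (radius j)⁻¹ * centre j := by
      change ((radius j)⁻¹ • !![centre j, fixPt j ^ 2; 1, centre j]) 0 0 = _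
      simp
    have h01 : ((pairingMatrix j : SL(2, ℝ)) : GL (Fin 2) ℝ) 0 1 =
        (radius j)⁻¹ * fixPt j ^ 2 := by
      change ((radius j)⁻¹ • !![centre j, fixPt j ^ 2; 1, centre j]) 0 1 = _
      simp
    have h11 : ((pairingMatrix j : SL(2, ℝ)) : GL (Fin 2) ℝ) 1 1 = (radius j)⁻¹ * centre j := by
      change ((radius j)⁻¹ • !![centre j, fixPt j ^ 2; 1, centre j]) 1 1 = _
      simp
    ext ξ
    induction ξ using OnePoint.rec with
    | infty => simp [OnePoint.smul_infty_eq_self_iff, h10, hr]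
    | coe x =>
      rw [Set.mem_ofPred_eq, OnePoint.smul_some_eq_ite, h10, h00, h01, h11]
      have e : (radius j)⁻¹ * x + (radius j)⁻¹ * centre j = (radius j)⁻¹ * (x + centre j) := by ring
      have e2 : (radius j)⁻¹ * centre j * x + (radius j)⁻¹ * fixPt j ^ 2 =
        (radius j)⁻¹ * (centre j * x + fixPt j ^ 2) := by ring
      rw [e, e2]
      -- The pole goes to `∞` and differs from both candidates, as `x_j < c_j`. Elsewhere the fixed
      -- point equation clears to `x² = x_j²`.
      by_cases h : x + centre j = 0
      · have : x = -centre j := by linarith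
        subst this
        simp
        constructor <;> intro <;> linarith
      · have h2 : (radius j)⁻¹ * (x + centre j) ≠ 0 := mul_ne_zero (inv_ne_zero hr) h
        rw [if_neg h2, mul_div_mul_left _ _ (inv_ne_zero hr)]
        simp only [OnePoint.coe_eq_coe, Set.mem_insert_iff, Set.mem_singleton_iff]
        rw [div_eq_iff h]
        constructor
        · intro e3
          have : (x - fixPt j) * (x + fixPt j) = 0 := by linear_combination -e3
          rcases mul_eq_zero.1 this with h | h
          · right; linarith
          · left; linarith
        · rintro (rfl | rfl) <;> ring
  circle := image_moebius_eq fun z => by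
    have h := norm_pos_iff.2 (coe_sub_ofReal_ne_zero z (-centre j))
    have hr := radius_pos j
    change ‖_‖ = _ ↔ ‖_‖ = _
    rw [norm_coe_moebius_sub_centre, div_eq_iff h.ne', sq, mul_right_inj' hr.ne', eq_comm]
  ext_int := image_moebius_eq fun z => by
    have h := norm_pos_iff.2 (coe_sub_ofReal_ne_zero z (-centre j))
    have hr := radius_pos j
    change _ < ‖_‖ ↔ ‖_‖ < _
    rw [norm_coe_moebius_sub_centre, div_lt_iff₀ h, sq, mul_lt_mul_iff_right₀ hr]

/-! ### Countable systems of contractions -/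

open MeasureTheory in
/-- A family of sets which is covered by its images under countably many contractions has Hausdorff
dimension at most `s` if the `s`-th powers of the ratios sum up to at most `1`. -/
theorem dimH_iUnion_le_of_contractions {X ι : Type*} [EMetricSpace X] [Countable ι]
    (E : ι → Set X) (g : ι → X → X) (u : ι → ℝ≥0∞) (adj : ι → ι → Prop) (s : NNReal) (hs : 0 < s)
    (hE : ∀ a, E a ⊆ ⋃ b, ⋃ _ : adj a b, g a '' E b)
    (hg : ∀ a b, adj a b → ∀ x ∈ E b, ∀ y ∈ E b, edist (g a x) (g a y) ≤ u a * edist x y)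
    (hu : ∑' a, u a ^ (s : ℝ) ≤ 1) {q : ℝ≥0∞} (hq : q < 1) (huq : ∀ a, u a ≤ q)
    (hd : ∑' a, Metric.ediam (E a) ^ (s : ℝ) ≠ ∞) : dimH (⋃ a, E a) ≤ s := by
  borelize X
  set S := ∑' a, Metric.ediam (E a) ^ (s : ℝ) with hS
  -- Covers of level `n`, each piece labelled by the set `E a` that contains it. The total
  -- `s`-weight never exceeds that of the initial family, while the diameters decay like `q ^ n`.
  have key (n : ℕ) : ∃ (κ : Type _) (_ : Countable κ) (head : κ → ι) (t : κ → Set X),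
      (∀ i, t i ⊆ E (head i)) ∧ (∀ a, E a ⊆ ⋃ i, ⋃ _ : head i = a, t i) ∧
      (∀ i, Metric.ediam (t i) ≤ q ^ n * S ^ (s : ℝ)⁻¹) ∧
      ∑' i, Metric.ediam (t i) ^ (s : ℝ) ≤ S := by
    induction n with
    | zero =>
      refine ⟨ι, inferInstance, id, E, fun i => subset_rfl, fun a => ?_, fun i => ?_, le_rfl⟩
      · exact Set.subset_iUnion₂_of_subset a rfl subset_rfl
      · rw [pow_zero, one_mul, ENNReal.le_rpow_inv_iff (by exact_mod_cast hs)]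
        exact ENNReal.le_tsum i
    | succ n ih =>
      obtain ⟨κ, hκ, head, t, h1, h2, h3, h4⟩ := ih
      -- Non-adjacent pairs stay in the index type but give an empty piece, so the weight of the new
      -- cover is bounded by a product of two sums.
      have hdiam (p : ι × κ) : Metric.ediam {x | x ∈ E p.1 ∧ adj p.1 (head p.2) ∧
          x ∈ g p.1 '' t p.2} ≤ u p.1 * Metric.ediam (t p.2) := by
        refine Metric.ediam_le ?_
        rintro _ ⟨-, hp, x, hx, rfl⟩ _ ⟨-, -, y, hy, rfl⟩
        refine (hg _ _ hp x (h1 _ hx) y (h1 _ hy)).trans ?_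
        gcongr
        exact Metric.edist_le_ediam_of_mem hx hy
      refine ⟨ι × κ, inferInstance, Prod.fst, fun p => {x | x ∈ E p.1 ∧ adj p.1 (head p.2) ∧
          x ∈ g p.1 '' t p.2}, fun p x hx => hx.1, fun a x hx => ?_, fun p => ?_, ?_⟩
      · obtain ⟨b, hx'⟩ := Set.mem_iUnion.1 (hE a hx)
        obtain ⟨hab, y, hy, rfl⟩ := Set.mem_iUnion.1 hx'
        obtain ⟨i, hy'⟩ := Set.mem_iUnion.1 (h2 b hy)
        obtain ⟨rfl, hyi⟩ := Set.mem_iUnion.1 hy'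
        exact Set.mem_iUnion₂.2 ⟨(a, i), rfl, hx, hab, y, hyi, rfl⟩
      · refine (hdiam p).trans ?_
        rw [pow_succ', mul_assoc]
        exact mul_le_mul' (huq _) (h3 _)
      · calc _ ≤ ∑' p : ι × κ, u p.1 ^ (s : ℝ) * Metric.ediam (t p.2) ^ (s : ℝ) := by
              refine ENNReal.tsum_le_tsum fun p => ?_
              rw [← ENNReal.mul_rpow_of_nonneg _ _ s.coe_nonneg]
              exact ENNReal.rpow_le_rpow (hdiam p) s.coe_nonneg
          _ = (∑' a, u a ^ (s : ℝ)) * ∑' i, Metric.ediam (t i) ^ (s : ℝ) := by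
              rw [ENNReal.tsum_prod (f := fun a i => u a ^ (s : ℝ) * Metric.ediam (t i) ^ (s : ℝ)), ← ENNReal.tsum_mul_right]
              simp_rw [ENNReal.tsum_mul_left]
          _ ≤ 1 * S := mul_le_mul' hu h4
          _ = S := one_mul S
  choose κ hκ head t h1 h2 h3 h4 using key
  refine dimH_le_of_hausdorffMeasure_ne_top ?_
  have hlim : Tendsto (fun n : ℕ => q ^ n * S ^ (s : ℝ)⁻¹) atTop (𝓝 0) := by
    have hfin : S ^ (s : ℝ)⁻¹ ≠ ∞ := ENNReal.rpow_ne_top_of_nonneg (by positivity) hd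
    have := ENNReal.Tendsto.mul_const (ENNReal.tendsto_pow_atTop_nhds_zero_of_lt_one hq)
      (Or.inr hfin)
    rwa [zero_mul] at this
  have := Measure.hausdorffMeasure_le_liminf_tsum (s : ℝ) (⋃ a, E a) _ hlim t
    (Eventually.of_forall fun n i => h3 n i) (Eventually.of_forall fun n x hx => by
      obtain ⟨a, ha⟩ := Set.mem_iUnion.1 hx
      obtain ⟨i, hi⟩ := Set.mem_iUnion.1 (h2 n a ha)
      obtain ⟨-, hi⟩ := Set.mem_iUnion.1 hi
      exact Set.mem_iUnion.2 ⟨i, hi⟩)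
  refine ne_top_of_le_ne_top hd (this.trans ?_)
  exact (liminf_le_liminf (Eventually.of_forall h4)).trans (by simp)

/-! ### Coded points -/

/-- The Möbius transformation of a letter, on the real line. -/
def realMap (a : ℕ × Bool) (x : ℝ) : ℝ := letterCentre a - radius a.1 ^ 2 / (x + letterCentre a)

theorem ofReal_realMap (a : ℕ × Bool) (x : ℝ) : ((realMap a x : ℝ) : ℂ) = letterMap a x := by
  simp [realMap, letterMap]

theorem norm_ofReal_sub_ofReal (x y : ℝ) : ‖(x : ℂ) - y‖ = |x - y| := by
  rw [← Complex.ofReal_sub, Complex.norm_real, Real.norm_eq_abs]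

theorem abs_realMap_sub_realMap_le {a b b' : ℕ × Bool} (hab : Adj a b) (hab' : Adj a b')
    {x y : ℝ} (hx : |x - letterCentre b| ≤ radius b.1) (hy : |y - letterCentre b'| ≤ radius b'.1) :
    |realMap a x - realMap a y| ≤ ratio a.1 * |x - y| := by
  rw [← norm_ofReal_sub_ofReal] at hx hy
  have := norm_letterMap_sub_letterMap_le hab hab' hx hy
  rwa [← ofReal_realMap, ← ofReal_realMap, norm_ofReal_sub_ofReal, norm_ofReal_sub_ofReal] at this

/-- `A` is a reduced infinite word which codes `X 0`; the other `X n` are coded by its shifts. -/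
structure IsCoding (A : ℕ → ℕ × Bool) (X : ℕ → ℝ) : Prop where
  adj : ∀ n, Adj (A n) (A (n + 1))
  mem : ∀ n, |X n - letterCentre (A n)| ≤ radius (A n).1
  eq : ∀ n, X n = realMap (A n) (X (n + 1))

theorem IsCoding.shift {A : ℕ → ℕ × Bool} {X : ℕ → ℝ} (h : IsCoding A X) (m : ℕ) :
    IsCoding (fun n => A (m + n)) (fun n => X (m + n)) :=
  ⟨fun _ => h.adj _, fun _ => h.mem _, fun _ => h.eq _⟩

/-- The points coded by a word with first letter `a` whose letters have index at least `k` from the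
`N`-th one on. -/
def codedSet (k N : ℕ) (a : ℕ × Bool) : Set ℝ :=
  {x | ∃ A X, IsCoding A X ∧ A 0 = a ∧ X 0 = x ∧ ∀ n, N ≤ n → k ≤ (A n).1}

/-- Dropping the first letter shifts the code. The case `M = N = 0` is the self-covering used for
the dimension bound; `M = N + 1` removes one unrestricted letter. -/
theorem codedSet_subset {k M N : ℕ} (h : M ≤ N + 1) (a : ℕ × Bool) : codedSet k M a ⊆
    ⋃ b, ⋃ _ : Adj a b, realMap a '' codedSet k N b := by
  rintro _ ⟨A, X, hAX, rfl, rfl, hk⟩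
  refine Set.mem_iUnion₂.2 ⟨A 1, hAX.adj 0, X 1, ⟨_, _, hAX.shift 1, rfl, rfl, fun n hn => ?_⟩,
    (hAX.eq 0).symm⟩
  exact hk _ (by omega)

theorem abs_sub_le_of_mem_codedSet {k N : ℕ} {a : ℕ × Bool} {x : ℝ} (hx : x ∈ codedSet k N a) :
    |x - letterCentre a| ≤ radius a.1 := by
  obtain ⟨A, X, hAX, rfl, rfl, -⟩ := hx
  exact hAX.mem 0

theorem codedSet_zero_eq_empty {k : ℕ} {a : ℕ × Bool} (h : a.1 < k) : codedSet k 0 a = ∅ := by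
  rw [Set.eq_empty_iff_forall_notMem]
  rintro x ⟨A, X, -, rfl, -, hk⟩
  exact absurd (hk 0 le_rfl) (not_le.2 h)

/-- The quadratic exponent in `x_j` is used here: `4 r_j / x_j = 2^(-j-j²)`, and `j + j² ≥ (j + 1)
k` once `j ≥ k`. Squaring gives the exponent `2k` that the power `1/(2k)` cancels. -/
theorem ratio_rpow_le {k j : ℕ} (hk : 1 ≤ k) (hkj : k ≤ j) :
    ENNReal.ofReal (ratio j) ^ ((2 * k : ℝ)⁻¹) ≤ (2⁻¹ : ℝ≥0∞) ^ (j + 1) := by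
  have hk0 : (0 : ℝ) < 2 * k := by positivity
  rw [ENNReal.rpow_inv_le_iff hk0, show (2 * k : ℝ) = ((2 * k : ℕ) : ℝ) by push_cast; rfl,
    ENNReal.rpow_natCast, ← pow_mul]
  have h1 : 4 * radius j / centre j ≤ (2⁻¹ : ℝ) ^ ((j + 1) * k) := by
    have h2 : 4 * radius j / centre j ≤ 4 * radius j / fixPt j := by
      have := one_le_fixPt j
      have := radius_pos j
      have := fixPt_lt_centre j
      gcongr
    have h3 : 4 * radius j / fixPt j = (2⁻¹ : ℝ) ^ (j + j ^ 2) := by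
      rw [radius, fixPt, inv_pow, pow_add, pow_add]
      field_simp
      norm_num
    refine h2.trans (h3.le.trans (pow_le_pow_of_le_one (by norm_num) (by norm_num) ?_))
    nlinarith
  have h2 : ratio j ≤ (2⁻¹ : ℝ) ^ ((j + 1) * (2 * k)) := by
    rw [ratio, mul_left_comm, mul_comm 2, pow_mul]
    have := centre_pos j
    have := radius_pos j
    gcongr
  refine (ENNReal.ofReal_le_ofReal h2).trans_eq ?_
  rw [ENNReal.ofReal_pow (by norm_num), ENNReal.ofReal_inv_of_pos (by norm_num), ENNReal.ofReal_ofNat]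

theorem ediam_codedSet_le (k N : ℕ) (a : ℕ × Bool) :
    Metric.ediam (codedSet k N a) ≤ (2⁻¹ : ℝ≥0∞) ^ (a.1 + 1) := by
  refine Metric.ediam_le fun x hx y hy => ?_
  have h1 := abs_sub_le_of_mem_codedSet hx
  have h2 := abs_sub_le_of_mem_codedSet hy
  have h3 : dist x y ≤ (2⁻¹ : ℝ) ^ (a.1 + 1) := by
    have h4 : 2 * radius a.1 = (2⁻¹ : ℝ) ^ (a.1 + 1) := by
      rw [radius, inv_pow, pow_add, pow_add]
      field_simp
    rw [Real.dist_eq, ← h4]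
    rw [abs_le] at *
    constructor <;> linarith
  rw [edist_dist]
  refine (ENNReal.ofReal_le_ofReal h3).trans_eq ?_
  rw [ENNReal.ofReal_pow (by norm_num), ENNReal.ofReal_inv_of_pos (by norm_num), ENNReal.ofReal_ofNat]

theorem dimH_iUnion_codedSet_le {k : ℕ} (hk : 1 ≤ k) :
    dimH (⋃ p : ℕ × Bool, codedSet k 0 (k + p.1, p.2)) ≤ 1 / (2 * (k : ℝ≥0∞)) := by
  have hk0 : (0 : ℝ) < 2 * k := by positivity
  have hs : (((2 * k : NNReal)⁻¹ : NNReal) : ℝ) = (2 * k : ℝ)⁻¹ := by push_cast; rfl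
  have hs' : (((2 * k : NNReal)⁻¹ : NNReal) : ℝ≥0∞) = 1 / (2 * (k : ℝ≥0∞)) := by
    rw [ENNReal.coe_inv (by positivity), one_div]
    push_cast
    rfl
  rw [← hs']
  refine dimH_iUnion_le_of_contractions _ (fun p => realMap (k + p.1, p.2))
    (fun p => ENNReal.ofReal (ratio (k + p.1))) (fun p q => Adj (k + p.1, p.2) (k + q.1, q.2))
    _ (by positivity) (fun p x hx => ?_) (fun p q hpq x hx y hy => ?_) ?_
    (q := ENNReal.ofReal (16 / 17)) ?_ (fun p => ENNReal.ofReal_le_ofReal (ratio_le _)) ?_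
  · obtain ⟨b, hx⟩ := Set.mem_iUnion.1 (codedSet_subset (Nat.zero_le _) _ hx)
    obtain ⟨hb, hx⟩ := Set.mem_iUnion.1 hx
    have hkb : k ≤ b.1 := by
      by_contra h
      rw [codedSet_zero_eq_empty (not_le.1 h)] at hx
      simp at hx
    have e : b = (k + (b.1 - k), b.2) := by rw [Nat.add_sub_cancel' hkb]
    rw [e] at hb hx
    exact Set.mem_iUnion₂.2 ⟨(b.1 - k, b.2), hb, hx⟩
  · rw [edist_dist, edist_dist, ← ENNReal.ofReal_mul (ratio_nonneg _)]
    exact ENNReal.ofReal_le_ofReal (abs_realMap_sub_realMap_le hpq hpq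
      (abs_sub_le_of_mem_codedSet hx) (abs_sub_le_of_mem_codedSet hy))
  · rw [hs]
    -- The two signs turn `2^(-(j+1))` into `2^(-j)`, and the sum over `j ≥ k` is `2^(1-k) ≤ 1`.
    calc ∑' p : ℕ × Bool, ENNReal.ofReal (ratio (k + p.1)) ^ ((2 * k : ℝ)⁻¹)
        ≤ ∑' p : ℕ × Bool, (2⁻¹ : ℝ≥0∞) ^ (k + p.1 + 1) :=
          ENNReal.tsum_le_tsum fun p => ratio_rpow_le hk (by omega)
      _ = ∑' m : ℕ, (2⁻¹ : ℝ≥0∞) ^ k * 2⁻¹ ^ m := by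
          rw [ENNReal.tsum_prod (f := fun m _ => (2⁻¹ : ℝ≥0∞) ^ (k + m + 1))]
          congr 1
          ext m
          rw [tsum_bool, pow_succ, ← mul_add, ENNReal.inv_two_add_inv_two, mul_one, pow_add]
      _ = 2⁻¹ ^ k * 2 := by
          rw [ENNReal.tsum_mul_left, ENNReal.tsum_geometric, ENNReal.one_sub_inv_two, inv_inv]
      _ ≤ 2⁻¹ ^ 1 * 2 := by
          exact mul_le_mul_left (pow_le_pow_right_of_le_one' (by simp) hk) _
      _ = 1 := by
          rw [pow_one, ENNReal.inv_mul_cancel] <;> simp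
  · rw [← ENNReal.ofReal_one]
    exact (ENNReal.ofReal_lt_ofReal_iff one_pos).2 (by norm_num)
  · rw [hs]
    set ρ : ℝ≥0∞ := 2⁻¹ ^ ((2 * k : ℝ)⁻¹) with hρ
    have hρ1 : ρ < 1 := ENNReal.rpow_lt_one (by simp) (by positivity)
    have hle : ∑' p : ℕ × Bool, Metric.ediam (codedSet k 0 (k + p.1, p.2)) ^ ((2 * k : ℝ)⁻¹) ≤
        ∑' p : ℕ × Bool, ρ ^ p.1 := by
      refine ENNReal.tsum_le_tsum fun p => ?_
      refine (ENNReal.rpow_le_rpow (ediam_codedSet_le _ _ _) (by positivity)).trans ?_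
      rw [hρ, ← ENNReal.rpow_natCast, ← ENNReal.rpow_mul, mul_comm, ENNReal.rpow_mul,
        ENNReal.rpow_natCast]
      exact pow_le_pow_right_of_le_one' hρ1.le (by simp; omega)
    refine ne_top_of_le_ne_top ?_ hle
    rw [ENNReal.tsum_prod (f := fun m _ => ρ ^ m)]
    simp_rw [tsum_bool, ← two_mul]
    rw [ENNReal.tsum_mul_left, ENNReal.tsum_geometric]
    refine ENNReal.mul_ne_top (by simp) ?_
    simpa [tsub_eq_zero_iff_le] using hρ1

/-- Each of the first `N` letters acts as a Lipschitz map, and there are countably many choices, so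
an arbitrary beginning does not raise the dimension. -/
theorem dimH_codedSet_le {k : ℕ} (hk : 1 ≤ k) (N : ℕ) (a : ℕ × Bool) :
    dimH (codedSet k N a) ≤ 1 / (2 * (k : ℝ≥0∞)) := by
  induction N generalizing a with
  | zero =>
    rcases lt_or_ge a.1 k with h | h
    · simp [codedSet_zero_eq_empty h]
    · refine le_trans (dimH_mono ?_) (dimH_iUnion_codedSet_le hk)
      refine Set.subset_iUnion_of_subset (a.1 - k, a.2) ?_
      rw [Nat.add_sub_cancel' h]
  | succ N ih =>
    refine (dimH_mono (codedSet_subset le_rfl a)).trans ?_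
    simp_rw [dimH_iUnion]
    refine iSup₂_le fun b hb => ?_
    refine le_trans (LipschitzOnWith.dimH_image_le (K := ⟨ratio a.1, ratio_nonneg _⟩) ?_) (ih b)
    refine LipschitzOnWith.of_dist_le_mul fun x hx y hy => ?_
    exact abs_realMap_sub_realMap_le hb hb
      (abs_sub_le_of_mem_codedSet hx) (abs_sub_le_of_mem_codedSet hy)

/-! ### Coding the limit points -/

/-- The points of the orbit of `I` given by reduced words which begin with `a` and have all letters
of index at least `k`. -/
def wordOrbit (k : ℕ) (a : ℕ × Bool) : Set ℂ :=
  {z | ∃ L, FreeGroup.IsReduced (a :: L) ∧ (∀ b ∈ a :: L, k ≤ b.1) ∧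
    ((wordIsom (a :: L) I : ℍ) : ℂ) = z}

/-- The orbit of the centres under the letters. -/
def centreOrbit : Set ℝ :=
  Set.range fun p : List (ℕ × Bool) × (ℕ × Bool) => p.1.foldr realMap (letterCentre p.2)

/-- A centre is the image of `∞` under its letter. Discs escaping to `∞` make such points limit
points where the coding may stop; countability makes them harmless for dimension. -/
theorem countable_centreOrbit : centreOrbit.Countable := Set.countable_range _

theorem letterCentre_mem_centreOrbit (a : ℕ × Bool) : letterCentre a ∈ centreOrbit := ⟨([], a), rfl⟩

theorem realMap_mem_centreOrbit (a : ℕ × Bool) {x : ℝ} (hx : x ∈ centreOrbit) :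
    realMap a x ∈ centreOrbit := by
  obtain ⟨⟨L, b⟩, rfl⟩ := hx
  exact ⟨(a :: L, b), rfl⟩

theorem norm_sub_le_of_mem_closure_wordOrbit {k : ℕ} {a : ℕ × Bool} {z : ℂ}
    (hz : z ∈ closure (wordOrbit k a)) : ‖z - letterCentre a‖ ≤ radius a.1 := by
  have h : closure (wordOrbit k a) ⊆ {z | ‖z - letterCentre a‖ ≤ radius a.1} := by
    refine closure_minimal ?_ (isClosed_le (by fun_prop) continuous_const)
    rintro _ ⟨L, hL, -, rfl⟩
    exact (norm_wordIsom_I_sub_lt hL).le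
  exact h hz

theorem le_of_mem_closure_wordOrbit {k : ℕ} {a : ℕ × Bool} {z : ℂ}
    (hz : z ∈ closure (wordOrbit k a)) : k ≤ a.1 := by
  obtain ⟨_, L, -, hL, -⟩ := closure_nonempty_iff.1 ⟨z, hz⟩
  exact hL a (by simp)

/-- The discs have bounded radius and their centres tend to infinity. Hence closure commutes with
the union, and a finite limit point has a well-defined piece to come from. -/
theorem locallyFinite_wordOrbit (k : ℕ) : LocallyFinite (wordOrbit k) := by
  intro z
  refine ⟨Metric.ball z 1, Metric.ball_mem_nhds z one_pos, ?_⟩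
  refine ((Set.finite_le_nat ⌊‖z‖ + 2⌋₊).prod (Set.finite_univ (α := Bool))).subset ?_
  rintro a ⟨w, hw, hwz⟩
  refine ⟨?_, trivial⟩
  have h1 := norm_sub_le_of_mem_closure_wordOrbit (subset_closure hw)
  have h2 := radius_le a.1
  have h3 : ‖w - z‖ < 1 := by rwa [mem_ball_iff_norm] at hwz
  have h4 : ‖(letterCentre a : ℂ)‖ = centre a.1 := by
    rw [Complex.norm_real, Real.norm_eq_abs, abs_letterCentre]
  have h5 : ‖(letterCentre a : ℂ)‖ ≤ ‖z‖ + ‖w - z‖ + ‖w - letterCentre a‖ := by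
    have : (letterCentre a : ℂ) = z + (w - z) - (w - letterCentre a) := by ring
    rw [this]
    refine (norm_sub_le _ _).trans ?_
    rw [← this]
    gcongr
    exact norm_add_le _ _
  have h6 := self_le_centre a.1
  exact Nat.le_floor (by linarith)

theorem ofReal_ne_I (x : ℝ) : (x : ℂ) ≠ Complex.I := by
  intro h
  have := congrArg Complex.im h
  simp at this

theorem exists_mem_closure_wordOrbit {k : ℕ} {x : ℝ}
    (hx : (x : ℂ) ∈ closure ((fun z : ℍ => (z : ℂ)) '' orbit (tailGroup pairingMatrix k) I)) :
    ∃ a, (x : ℂ) ∈ closure (wordOrbit k a) := by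
  have h : (fun z : ℍ => (z : ℂ)) '' orbit (tailGroup pairingMatrix k) I ⊆
      {Complex.I} ∪ ⋃ a, wordOrbit k a := by
    rintro _ ⟨_, ⟨γ, hγ, rfl⟩, rfl⟩
    obtain ⟨L, hL, hk, rfl⟩ := exists_reduced_word hγ
    rcases L with _ | ⟨a, L⟩
    · exact Or.inl rfl
    · exact Or.inr (Set.mem_iUnion.2 ⟨a, L, hL, hk, rfl⟩)
  have hx := closure_mono h hx
  rw [closure_union, closure_singleton, (locallyFinite_wordOrbit k).closure_iUnion] at hx
  rcases hx with hx | hx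
  · exact absurd hx (ofReal_ne_I x)
  · exact Set.mem_iUnion.1 hx

theorem realMap_realMap_invLetter (a : ℕ × Bool) {x : ℝ} (hx : x ≠ letterCentre a) :
    realMap a (realMap (invLetter a) x) = x := by
  have := letterMap_letterMap_invLetter a (z := x) (by exact_mod_cast hx)
  rw [← ofReal_realMap, ← ofReal_realMap] at this
  exact_mod_cast this

theorem continuousAt_letterMap (a : ℕ × Bool) {z : ℂ} (hz : z + letterCentre a ≠ 0) :
    ContinuousAt (letterMap a) z := by
  unfold letterMap
  exact continuousAt_const.sub (continuousAt_const.div (by fun_prop) hz)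

theorem letterMap_invLetter_coe_wordIsom (a : ℕ × Bool) (L : List (ℕ × Bool)) (z : ℍ) :
    letterMap (invLetter a) (wordIsom (a :: L) z : ℍ) = (wordIsom L z : ℍ) := by
  rw [← coe_letterIsom, letterIsom_invLetter, wordIsom_cons]
  congr 1
  exact (letterIsom a).symm_apply_apply _

/-- The inverse of the first letter is continuous away from its pole and strips that letter from the
approximating words. The empty word contributes only `I`, which is not real. -/
theorem exists_realMap_mem_closure_wordOrbit {k : ℕ} {a : ℕ × Bool} {x : ℝ}
    (hx : (x : ℂ) ∈ closure (wordOrbit k a)) (hxa : x ≠ letterCentre a) :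
    ∃ b, Adj a b ∧ ((realMap (invLetter a) x : ℝ) : ℂ) ∈ closure (wordOrbit k b) := by
  have hne : (x : ℂ) + letterCentre (invLetter a) ≠ 0 := by
    rw [letterCentre_invLetter, Complex.ofReal_neg, ← sub_eq_add_neg, sub_ne_zero]
    exact_mod_cast hxa
  have h1 := mem_closure_image (continuousAt_letterMap _ hne) hx
  have h2 : letterMap (invLetter a) '' wordOrbit k a ⊆
      {Complex.I} ∪ ⋃ b, {z | Adj a b ∧ z ∈ wordOrbit k b} := by
    rintro _ ⟨_, ⟨L, hL, hk, rfl⟩, rfl⟩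
    rw [letterMap_invLetter_coe_wordIsom]
    rcases L with _ | ⟨b, L⟩
    · exact Or.inl rfl
    · rw [FreeGroup.isReduced_cons_cons] at hL
      exact Or.inr (Set.mem_iUnion.2 ⟨b, hL.1, L, hL.2,
        fun c hc => hk c (List.mem_cons_of_mem _ hc), rfl⟩)
  have h3 := closure_mono h2 h1
  rw [closure_union, closure_singleton, ((locallyFinite_wordOrbit k).subset
    fun b z hz => hz.2).closure_iUnion, ← ofReal_realMap] at h3
  rcases h3 with h3 | h3
  · exact absurd h3 (ofReal_ne_I _)
  · obtain ⟨b, hb⟩ := Set.mem_iUnion.1 h3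
    obtain ⟨z, hz⟩ := closure_nonempty_iff.1 ⟨_, hb⟩
    exact ⟨b, hz.1, closure_mono (fun z hz => hz.2) hb⟩

/-- A real limit point is coded, unless it is in the orbit of the centres. -/
theorem exists_isCoding {k : ℕ} {x : ℝ}
    (hx : (x : ℂ) ∈ closure ((fun z : ℍ => (z : ℂ)) '' orbit (tailGroup pairingMatrix k) I))
    (hx' : x ∉ centreOrbit) : ∃ A X, IsCoding A X ∧ X 0 = x ∧ ∀ n, k ≤ (A n).1 := by
  obtain ⟨a, ha⟩ := exists_mem_closure_wordOrbit hx
  let T := {p : (ℕ × Bool) × ℝ // (p.2 : ℂ) ∈ closure (wordOrbit k p.1) ∧ p.2 ∉ centreOrbit}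
  have step (p : T) : ∃ q : T, Adj p.1.1 q.1.1 ∧ p.1.2 = realMap p.1.1 q.1.2 := by
    obtain ⟨⟨a, x⟩, hx, hx'⟩ := p
    have hxa : x ≠ letterCentre a := fun h => hx' (h ▸ letterCentre_mem_centreOrbit a)
    obtain ⟨b, hab, hb⟩ := exists_realMap_mem_closure_wordOrbit hx hxa
    have e := realMap_realMap_invLetter a hxa
    refine ⟨⟨(b, realMap (invLetter a) x), hb, fun h => hx' ?_⟩, hab, e.symm⟩
    rw [← e]
    exact realMap_mem_centreOrbit a h
  choose next h1 h2 using step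
  let s : ℕ → T := fun n => next^[n] ⟨(a, x), ha, hx'⟩
  have hs (n : ℕ) : s (n + 1) = next (s n) := Function.iterate_succ_apply' _ _ _
  refine ⟨fun n => (s n).1.1, fun n => (s n).1.2, ⟨fun n => ?_, fun n => ?_, fun n => ?_⟩, rfl,
    fun n => le_of_mem_closure_wordOrbit (s n).2.1⟩
  · rw [hs]
    exact h1 _
  · rw [← norm_ofReal_sub_ofReal]
    exact norm_sub_le_of_mem_closure_wordOrbit (s n).2.1
  · rw [hs]
    exact h2 _

/-! ### The boundary map -/

/-- The inverse of the Cayley transform. -/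
def cayleyInv (o : ℍ) (ζ : ℂ) : ℂ := (o - conj (o : ℂ) * ζ) / (1 - ζ)

theorem cayleyInv_div (o : ℍ) {z : ℂ} (hz : z - conj (o : ℂ) ≠ 0) :
    cayleyInv o ((z - o) / (z - conj (o : ℂ))) = z := by
  have ho : (o : ℂ) - conj (o : ℂ) ≠ 0 := sub_conj_ne_zero o o
  have h : 1 - (z - o) / (z - conj (o : ℂ)) = (o - conj (o : ℂ)) / (z - conj (o : ℂ)) := by
    field_simp
    ring
  rw [cayleyInv, h]
  field_simp
  ring

theorem ofReal_sub_conj_ne_zero (o : ℍ) (x : ℝ) : (x : ℂ) - conj (o : ℂ) ≠ 0 := by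
  intro h
  have h1 := congrArg Complex.im h
  have h3 := o.im_pos
  simp at h1
  linarith

theorem cayleyInv_discMap (o z : ℍ) : cayleyInv o (discMap o z) = z :=
  cayleyInv_div o (sub_conj_ne_zero o z)

theorem cayleyInv_bdryMap (o : ℍ) (x : ℝ) : cayleyInv o (bdryMap o (x : OnePoint ℝ)) = x :=
  cayleyInv_div o (ofReal_sub_conj_ne_zero o x)

theorem continuousAt_cayleyInv (o : ℍ) (x : ℝ) :
    ContinuousAt (cayleyInv o) (bdryMap o (x : OnePoint ℝ)) := by
  have hx := ofReal_sub_conj_ne_zero o x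
  have ho : (o : ℂ) - conj (o : ℂ) ≠ 0 := sub_conj_ne_zero o o
  have h : 1 - bdryMap o (x : OnePoint ℝ) = (o - conj (o : ℂ)) / (x - conj (o : ℂ)) := by
    change 1 - ((x : ℂ) - o) / (x - conj (o : ℂ)) = _
    field_simp
    ring
  unfold cayleyInv
  refine ContinuousAt.div (by fun_prop) (by fun_prop) ?_
  rw [h]
  exact div_ne_zero ho hx

theorem tendsto_coe_nhdsInfty (o : ℍ) (x : ℝ) :
    Tendsto (fun z : ℍ => (z : ℂ)) (nhdsInfty o (x : OnePoint ℝ)) (𝓝 (x : ℂ)) := by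
  have h := (continuousAt_cayleyInv o x).tendsto.comp
    (tendsto_comap : Tendsto (discMap o) (nhdsInfty o (x : OnePoint ℝ)) _)
  rw [cayleyInv_bdryMap] at h
  exact h.congr fun z => cayleyInv_discMap o z

theorem mem_closure_coe_orbit_of_mem_limitSet {Γ : Subgroup (ℍ ≃ᵢ ℍ)} {o : ℍ} {x : ℝ}
    (hx : (x : OnePoint ℝ) ∈ limitSet Γ o) :
    (x : ℂ) ∈ closure ((fun z : ℍ => (z : ℂ)) '' orbit Γ o) := by
  have h := mem_closure_image (continuousAt_cayleyInv o x) hx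
  rw [cayleyInv_bdryMap, Set.image_image] at h
  simpa only [cayleyInv_discMap] using h

/-- The real points in the closure of an orbit do not depend on the orbit. -/
theorem mem_closure_coe_orbit_of_mem_closure {Γ : Subgroup (ℍ ≃ᵢ ℍ)} {o : ℍ} (o' : ℍ) {x : ℝ}
    (hx : (x : ℂ) ∈ closure ((fun z : ℍ => (z : ℂ)) '' orbit Γ o)) :
    (x : ℂ) ∈ closure ((fun z : ℍ => (z : ℂ)) '' orbit Γ o') := by
  rw [Metric.mem_closure_iff] at hx ⊢
  intro ε hε
  set M := Real.exp (dist o' o) with hM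
  have hMpos : 0 < M := Real.exp_pos _
  obtain ⟨_, ⟨_, ⟨γ, hγ, rfl⟩, rfl⟩, h⟩ := hx (ε / M) (by positivity)
  refine ⟨_, ⟨_, ⟨γ, hγ, rfl⟩, rfl⟩, ?_⟩
  -- Near a real point the height of `γ o` is small, and the Euclidean distance from `γ o'` to `γ o`
  -- is at most that height times `M - 1`.
  have h1 := UpperHalfPlane.dist_coe_le (γ o') (γ o)
  have h2 : (γ o).im ≤ dist (x : ℂ) (γ o) := by
    rw [dist_comm, Complex.dist_eq]
    refine le_trans ?_ (Complex.abs_im_le_norm _)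
    simp [le_abs_self]
  rw [γ.dist_eq, ← hM] at h1
  have h3 := dist_triangle_right (x : ℂ) (γ o') (γ o)
  have h4 : 1 ≤ M := Real.one_le_exp dist_nonneg
  rw [lt_div_iff₀ hMpos] at h
  have h5 : dist ((γ o' : ℍ) : ℂ) (γ o) ≤ dist (x : ℂ) (γ o) * (M - 1) :=
    h1.trans (mul_le_mul_of_nonneg_right h2 (by linarith))
  change dist (x : ℂ) (γ o' : ℍ) < ε
  linarith

theorem norm_coe_sub_conj_ge (o : ℍ) (x : ℝ) : o.im ≤ ‖(x : ℂ) - conj (o : ℂ)‖ := by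
  refine le_trans ?_ (Complex.abs_im_le_norm _)
  simp [le_abs_self]

theorem dimH_image_bdryMap_le (o : ℍ) (S : Set ℝ) :
    dimH ((fun x : ℝ => bdryMap o (x : OnePoint ℝ)) '' S) ≤ dimH S := by
  have hy := o.im_pos
  refine LipschitzWith.dimH_image_le (K := ⟨2 / o.im, by positivity⟩)
    (LipschitzWith.of_dist_le_mul fun x y => ?_) S
  have hx' := ofReal_sub_conj_ne_zero o x
  have hy' := ofReal_sub_conj_ne_zero o y
  have e : bdryMap o (x : OnePoint ℝ) - bdryMap o (y : OnePoint ℝ) =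
      ((x : ℂ) - y) * ((o : ℂ) - conj (o : ℂ)) /
        (((x : ℂ) - conj (o : ℂ)) * ((y : ℂ) - conj (o : ℂ))) := by
    change ((x : ℂ) - o) / (x - conj (o : ℂ)) - ((y : ℂ) - o) / (y - conj (o : ℂ)) = _
    rw [div_sub_div _ _ hx' hy']
    congr 1
    ring
  have ho : ‖(o : ℂ) - conj (o : ℂ)‖ = 2 * o.im := by
    rw [Complex.sub_conj, norm_mul, Complex.norm_I, Complex.norm_real, mul_one, Real.norm_eq_abs,
      abs_of_pos (by simpa using hy)]
    rfl
  have h1 := norm_coe_sub_conj_ge o x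
  have h2 := norm_coe_sub_conj_ge o y
  rw [dist_eq_norm, e, norm_div, norm_mul, norm_mul, ho, norm_ofReal_sub_ofReal, Real.dist_eq,
    div_le_iff₀ (mul_pos (hy.trans_le h1) (hy.trans_le h2))]
  change |x - y| * (2 * o.im) ≤ 2 / o.im * |x - y| * _
  calc |x - y| * (2 * o.im) = 2 / o.im * |x - y| * (o.im * o.im) := by field_simp
    _ ≤ _ := by gcongr

theorem hausdorffDim_le {o : ℍ} {S : Set (OnePoint ℝ)} {T : Set ℝ} {d : ℝ≥0∞}
    (h : ∀ x : ℝ, (x : OnePoint ℝ) ∈ S → x ∈ T) (hT : dimH T ≤ d) : hausdorffDim o S ≤ d := by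
  have hS : bdryMap o '' S ⊆ {1} ∪ (fun x : ℝ => bdryMap o (x : OnePoint ℝ)) '' T := by
    rintro _ ⟨ξ, hξ, rfl⟩
    induction ξ using OnePoint.rec with
    | infty => exact Or.inl rfl
    | coe x => exact Or.inr ⟨x, h x hξ, rfl⟩
  refine (dimH_mono hS).trans ?_
  rw [dimH_union, dimH_singleton]
  exact max_le zero_le ((dimH_image_bdryMap_le o T).trans hT)

/-! ### Dimension of the limit sets of the tail groups -/

theorem hausdorffDim_limitSet_le {k : ℕ} (hk : 1 ≤ k) (o : ℍ) :
    hausdorffDim o (limitSet (tailGroup pairingMatrix k) o) ≤ 1 / (2 * (k : ℝ≥0∞)) := by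
  refine hausdorffDim_le (T := centreOrbit ∪ ⋃ a, codedSet k 0 a) (fun x hx => ?_) ?_
  · by_cases h : x ∈ centreOrbit
    · exact Or.inl h
    · obtain ⟨A, X, hAX, hX, hA⟩ := exists_isCoding (mem_closure_coe_orbit_of_mem_closure I
        (mem_closure_coe_orbit_of_mem_limitSet hx)) h
      exact Or.inr (Set.mem_iUnion.2 ⟨A 0, A, X, hAX, rfl, hX, fun n _ => hA n⟩)
  · rw [dimH_union, dimH_countable countable_centreOrbit, dimH_iUnion]
    exact max_le zero_le (iSup_le fun a => dimH_codedSet_le hk 0 a)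

/-! ### Geodesics and the Gromov product -/

/-- Ptolemy's inequality in the hyperbolic plane. -/
theorem sinh_half_dist_mul_le (a b c d : ℍ) :
    Real.sinh (dist a c / 2) * Real.sinh (dist b d / 2) ≤
      Real.sinh (dist a b / 2) * Real.sinh (dist c d / 2) +
        Real.sinh (dist b c / 2) * Real.sinh (dist a d / 2) := by
  have h := EuclideanGeometry.mul_dist_le_mul_dist_add_mul_dist (a : ℂ) b c d
  have ha := Real.sqrt_pos.2 a.im_pos
  have hb := Real.sqrt_pos.2 b.im_pos
  have hc := Real.sqrt_pos.2 c.im_pos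
  have hd := Real.sqrt_pos.2 d.im_pos
  simp only [UpperHalfPlane.sinh_half_dist, Real.sqrt_mul a.im_pos.le, Real.sqrt_mul b.im_pos.le,
    Real.sqrt_mul c.im_pos.le]
  generalize √a.im = α at *
  generalize √b.im = β at *
  generalize √c.im = γ at *
  generalize √d.im = δ at *
  have e1 : dist (a : ℂ) c / (2 * (α * γ)) * (dist (b : ℂ) d / (2 * (β * δ))) =
      dist (a : ℂ) c * dist (b : ℂ) d / (4 * (α * β * γ * δ)) := by field_simp; ring
  have e2 : dist (a : ℂ) b / (2 * (α * β)) * (dist (c : ℂ) d / (2 * (γ * δ))) +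
      dist (b : ℂ) c / (2 * (β * γ)) * (dist (a : ℂ) d / (2 * (α * δ))) =
      (dist (a : ℂ) b * dist (c : ℂ) d + dist (b : ℂ) c * dist (a : ℂ) d) /
        (4 * (α * β * γ * δ)) := by field_simp; ring
  rw [e1, e2]
  gcongr

theorem sinh_le_half_exp (x : ℝ) : Real.sinh x ≤ Real.exp x / 2 := by
  rw [Real.sinh_eq]
  have := Real.exp_pos (-x)
  linarith

theorem quarter_exp_le_sinh {x : ℝ} (hx : 1 ≤ x) : Real.exp x / 4 ≤ Real.sinh x := by
  rw [Real.sinh_eq, Real.exp_neg]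
  have h : 2 ≤ Real.exp x := by
    have := Real.add_one_le_exp x
    linarith
  have : (Real.exp x)⁻¹ ≤ 2⁻¹ := inv_anti₀ two_pos h
  linarith

/-- A geodesic passes within a bounded distance of any point from which the Gromov product of its
endpoints is bounded. -/
theorem exists_dist_le_of_gromovProduct_le {c : ℝ → ℍ}
    (hc : ∀ s t : ℝ, 0 ≤ s → 0 ≤ t → dist (c s) (c t) = |s - t|) (q : ℍ) {s M : ℝ} (hs : 2 ≤ s)
    (hM : gromovProduct q (c 0) (c s) ≤ M) :
    ∃ t, 0 ≤ t ∧ dist q (c t) ≤ 4 * Real.exp (M / 2) := by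
  set A := dist q (c 0) with hA
  set B := dist q (c s) with hB
  have h0s : dist (c 0) (c s) = s := by
    rw [hc 0 s le_rfl (by linarith), zero_sub, abs_neg, abs_of_nonneg (by linarith)]
  rw [gromovProduct, h0s, dist_comm (c 0) q, ← hA, ← hB] at hM
  have t1 : B ≤ A + s := by
    have := dist_triangle q (c 0) (c s)
    rwa [h0s] at this
  have t2 : A ≤ B + s := by
    have := dist_triangle q (c s) (c 0)
    rwa [dist_comm (c s), h0s] at this
  -- The foot of the tripod comparing with the triangle `q`, `c 0`, `c s`. It makes both products on
  -- the right of Ptolemy's inequality at most `exp ((A + B + s) / 4) / 4`.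
  set t := (A + s - B) / 2 with ht
  have ht0 : 0 ≤ t := by linarith
  have hts : t ≤ s := by linarith
  have h0t : dist (c 0) (c t) = t := by
    rw [hc 0 t le_rfl ht0, zero_sub, abs_neg, abs_of_nonneg ht0]
  have hst : dist (c t) (c s) = s - t := by
    rw [hc t s ht0 (by linarith), abs_sub_comm, abs_of_nonneg (by linarith)]
  refine ⟨t, ht0, ?_⟩
  have P := sinh_half_dist_mul_le q (c 0) (c t) (c s)
  rw [h0s, h0t, hst, ← hA, ← hB] at P
  have nn (x : ℝ) (hx : 0 ≤ x) : 0 ≤ Real.sinh (x / 2) := Real.sinh_nonneg_iff.2 (by linarith)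
  have hA0 : 0 ≤ A := dist_nonneg
  have hB0 : 0 ≤ B := dist_nonneg
  have u1 : Real.sinh (A / 2) * Real.sinh ((s - t) / 2) ≤
      Real.exp (A / 2) / 2 * (Real.exp ((s - t) / 2) / 2) :=
    mul_le_mul (sinh_le_half_exp _) (sinh_le_half_exp _) (nn _ (by linarith)) (by positivity)
  have u2 : Real.sinh (t / 2) * Real.sinh (B / 2) ≤
      Real.exp (t / 2) / 2 * (Real.exp (B / 2) / 2) :=
    mul_le_mul (sinh_le_half_exp _) (sinh_le_half_exp _) (nn _ hB0) (by positivity)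
  have v1 : Real.exp (A / 2) / 2 * (Real.exp ((s - t) / 2) / 2) =
      Real.exp ((A + B + s) / 4) / 4 := by
    rw [div_mul_div_comm, ← Real.exp_add]
    congr 2
    · rw [ht]; ring
    · norm_num
  have v2 : Real.exp (t / 2) / 2 * (Real.exp (B / 2) / 2) = Real.exp ((A + B + s) / 4) / 4 := by
    rw [div_mul_div_comm, ← Real.exp_add]
    congr 2
    · rw [ht]; ring
    · norm_num
  have w1 : dist q (c t) / 2 ≤ Real.sinh (dist q (c t) / 2) :=
    Real.self_le_sinh_iff.2 (by positivity)
  have w2 := quarter_exp_le_sinh (x := s / 2) (by linarith)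
  have w3 : dist q (c t) / 2 * (Real.exp (s / 2) / 4) ≤ Real.exp ((A + B + s) / 4) / 2 := by
    calc _ ≤ Real.sinh (dist q (c t) / 2) * Real.sinh (s / 2) := by gcongr
      _ ≤ _ := by linarith
  have w4 : Real.exp ((A + B + s) / 4) ≤ Real.exp (M / 2) * Real.exp (s / 2) := by
    rw [← Real.exp_add]
    exact Real.exp_le_exp.2 (by linarith)
  have hpos := Real.exp_pos (s / 2)
  refine le_of_mul_le_mul_right ?_ hpos
  linarith

theorem gromovProduct_apply (γ : ℍ ≃ᵢ ℍ) (q z w : ℍ) :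
    gromovProduct (γ q) z w = gromovProduct q (γ⁻¹ z) (γ⁻¹ w) := by
  have h (x y : ℍ) : dist (γ⁻¹ x) (γ⁻¹ y) = dist x y := (γ⁻¹).dist_eq x y
  have hq : γ⁻¹ (γ q) = q := γ.symm_apply_apply q
  rw [gromovProduct, gromovProduct, ← h z, ← h (γ q), ← h z w, hq]

theorem gromovProduct_le_add_dist (q z z' w : ℍ) :
    gromovProduct q z w ≤ gromovProduct q z' w + dist z z' := by
  have h1 := dist_triangle z z' q
  have h2 := dist_triangle z' z w
  rw [dist_comm z' z] at h2
  rw [gromovProduct, gromovProduct]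
  linarith

/-- The left side is half the chord in the disc model; `exp_neg_gromovProduct` only multiplies it by
factors at least 1 and adds a positive term. -/
theorem norm_div_le_exp_neg_gromovProduct (z w : ℍ) :
    ‖(z : ℂ) - w‖ / (‖(z : ℂ) + Complex.I‖ * ‖(w : ℂ) + Complex.I‖) ≤
      Real.exp (-gromovProduct I z w) := by
  have hz : (z : ℂ) + Complex.I ≠ 0 := by simpa using sub_conj_ne_zero I z
  have hw : (w : ℂ) + Complex.I ≠ 0 := by simpa using sub_conj_ne_zero I w
  have e : discMap I z - discMap I w =
      2 * Complex.I * (z - w) / ((z + Complex.I) * (w + Complex.I)) := by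
    simp only [discMap, UpperHalfPlane.coe_I, Complex.conj_I, sub_neg_eq_add]
    field_simp
    ring
  have h := congrArg norm e
  rw [norm_div, norm_mul, norm_mul, norm_mul, Complex.norm_two, Complex.norm_I, mul_one] at h
  have h2 : ‖discMap I z - discMap I w‖ / 2 =
      ‖(z : ℂ) - w‖ / (‖(z : ℂ) + Complex.I‖ * ‖(w : ℂ) + Complex.I‖) := by rw [h]; ring
  rw [exp_neg_gromovProduct, h2]
  have e1 := Real.exp_pos (-dist z I)
  have e2 := Real.exp_pos (-dist w I)
  have h3 : 1 ≤ (1 + Real.exp (-dist z I)) * (1 + Real.exp (-dist w I)) := by nlinarith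
  rw [mul_assoc]
  exact (le_mul_of_one_le_right (by positivity) h3).trans (le_add_of_nonneg_right (by positivity))

/-- Points of the discs of two letters that are not inverse to each other have bounded Gromov
product. -/
theorem exp_neg_gromovProduct_ge {a b : ℕ × Bool} (hab : Adj a b) (ha : 1 ≤ a.1) {z w : ℍ}
    (hz : ‖(z : ℂ) - letterCentre (invLetter a)‖ ≤ radius a.1)
    (hw : ‖(w : ℂ) - letterCentre b‖ ≤ radius b.1) :
    1 / (24 * (centre a.1 + 2)) ≤ Real.exp (-gromovProduct I z w) := by
  refine le_trans ?_ (norm_div_le_exp_neg_gromovProduct z w)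
  have ra := radius_le a.1
  have rb := radius_le b.1
  have ca : 2 ≤ centre a.1 := by
    have := fixPt_lt_centre a.1
    have := two_mul_fixPt_le ha
    have := one_le_fixPt 0
    linarith
  have cb := one_lt_centre b.1
  have h1 := le_norm_add_letterCentre hab hw
  rw [letterCentre_invLetter, Complex.ofReal_neg, sub_neg_eq_add] at hz
  have h2 : ‖(w : ℂ) + letterCentre a‖ ≤ ‖(z : ℂ) - w‖ + ‖(z : ℂ) + letterCentre a‖ := by
    rw [← norm_neg ((z : ℂ) - w)]
    refine le_trans (le_of_eq ?_) (norm_add_le _ _)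
    congr 1
    ring
  have hmax := le_max_left (centre a.1) (centre b.1)
  have hmax' := le_max_right (centre a.1) (centre b.1)
  have nc (a : ℕ × Bool) : ‖(letterCentre a : ℂ)‖ = centre a.1 := by
    rw [Complex.norm_real, Real.norm_eq_abs, abs_letterCentre]
  have h3 : ‖(z : ℂ) + Complex.I‖ ≤ centre a.1 + 2 := by
    have : (z : ℂ) + Complex.I = (z + letterCentre a) - letterCentre a + Complex.I := by ring
    rw [this]
    refine (norm_add_le _ _).trans ?_
    have := norm_sub_le ((z : ℂ) + letterCentre a) (letterCentre a)
    rw [nc] at this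
    rw [Complex.norm_I]
    linarith
  have h4 : ‖(w : ℂ) + Complex.I‖ ≤ 3 * centre b.1 := by
    have : (w : ℂ) + Complex.I = (w - letterCentre b) + letterCentre b + Complex.I := by ring
    rw [this]
    refine (norm_add_le _ _).trans ?_
    have := norm_add_le ((w : ℂ) - letterCentre b) (letterCentre b)
    rw [nc] at this
    rw [Complex.norm_I]
    linarith
  have hz0 : 0 < ‖(z : ℂ) + Complex.I‖ :=
    norm_pos_iff.2 (by simpa using sub_conj_ne_zero I z)
  have hw0 : 0 < ‖(w : ℂ) + Complex.I‖ :=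
    norm_pos_iff.2 (by simpa using sub_conj_ne_zero I w)
  -- The distance is at least a quarter of the larger centre minus 1/4, and that centre is at least
  -- 2. Since `‖w + I‖` is also of order `centre b.1`, the index of `b` cancels and the final bound
  -- depends on `a` only.
  have h5 : centre b.1 / 8 ≤ ‖(z : ℂ) - w‖ := by linarith
  calc 1 / (24 * (centre a.1 + 2)) = centre b.1 / 8 / ((centre a.1 + 2) * (3 * centre b.1)) := by
        field_simp; norm_num
    _ ≤ _ := by gcongr

/-! ### The transient limit set -/

/-- The isometry of the prefix of length `n` of an infinite word. -/
def prefixIsom (A : ℕ → ℕ × Bool) : ℕ → (ℍ ≃ᵢ ℍ)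
  | 0 => 1
  | n + 1 => prefixIsom A n * letterIsom (A n)

theorem prefixIsom_mem_tailGroup {k : ℕ} {A : ℕ → ℕ × Bool} (hA : ∀ n, k ≤ (A n).1) (n : ℕ) :
    prefixIsom A n ∈ tailGroup pairingMatrix k := by
  induction n with
  | zero => exact one_mem _
  | succ n ih => exact mul_mem ih (letterIsom_mem_tailGroup (hA n))

theorem coe_prefixIsom_succ_inv (A : ℕ → ℕ × Bool) (n : ℕ) (z : ℍ) :
    (((prefixIsom A (n + 1))⁻¹ z : ℍ) : ℂ) =
      letterMap (invLetter (A n)) (((prefixIsom A n)⁻¹ z : ℍ) : ℂ) := by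
  rw [← coe_letterIsom, letterIsom_invLetter, prefixIsom, mul_inv_rev]
  rfl

theorem IsCoding.norm_lt {A : ℕ → ℕ × Bool} {X : ℕ → ℝ} (h : IsCoding A X) (n : ℕ) :
    ‖(X n : ℂ) - letterCentre (A n)‖ < radius (A n).1 := by
  rw [h.eq, ofReal_realMap]
  refine norm_letterMap_sub_lt_of_adj (h.adj n) ?_
  rw [norm_ofReal_sub_ofReal]
  exact h.mem _

/-- The inverse of a prefix is a reduced word beginning with the inverse of the last letter, so
ping-pong applies. -/
theorem norm_prefixIsom_inv_I_sub_lt {A : ℕ → ℕ × Bool} (hA : ∀ n, Adj (A n) (A (n + 1))) (n : ℕ) :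
    ‖(((prefixIsom A (n + 1))⁻¹ I : ℍ) : ℂ) - letterCentre (invLetter (A n))‖ <
      radius (A n).1 := by
  induction n with
  | zero =>
    rw [coe_prefixIsom_succ_inv]
    simpa [prefixIsom] using norm_letterMap_I_sub_lt (invLetter (A 0))
  | succ n ih =>
    rw [coe_prefixIsom_succ_inv]
    exact norm_letterMap_sub_lt_of_adj (hA n).invLetter ih.le

theorem IsCoding.letterMap_invLetter {A : ℕ → ℕ × Bool} {X : ℕ → ℝ} (h : IsCoding A X) (n : ℕ) :
    letterMap (invLetter (A n)) (X n) = X (n + 1) := by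
  have h1 : (X (n + 1) : ℂ) + letterCentre (A n) ≠ 0 :=
    add_letterCentre_ne_zero (h.adj n) (h.norm_lt (n + 1)).le
  rw [h.eq n, ofReal_realMap]
  have := letterMap_letterMap_invLetter (invLetter (A n)) (z := X (n + 1)) (by
    rw [letterCentre_invLetter, Complex.ofReal_neg]
    exact fun e => h1 (by rw [e]; ring))
  rwa [invLetter_invLetter] at this

theorem IsCoding.ne_letterCentre {A : ℕ → ℕ × Bool} {X : ℕ → ℝ} (h : IsCoding A X) (n : ℕ) :
    (X n : ℂ) + letterCentre (invLetter (A n)) ≠ 0 := by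
  have h1 : (X (n + 1) : ℂ) + letterCentre (A n) ≠ 0 :=
    add_letterCentre_ne_zero (h.adj n) (h.norm_lt (n + 1)).le
  have h2 : (radius (A n).1 : ℂ) ≠ 0 := by exact_mod_cast (radius_pos _).ne'
  rw [h.eq n, ofReal_realMap, letterMap, letterCentre_invLetter]
  have : (letterCentre (A n) : ℂ) - radius (A n).1 ^ 2 / (X (n + 1) + letterCentre (A n)) +
    (-letterCentre (A n) : ℝ) = -(radius (A n).1 ^ 2 / (X (n + 1) + letterCentre (A n))) := by
      push_cast; ring
  rw [this]
  exact neg_ne_zero.2 (div_ne_zero (pow_ne_zero 2 h2) h1)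

theorem IsCoding.tendsto_prefixIsom_inv {A : ℕ → ℕ × Bool} {X : ℕ → ℝ} (h : IsCoding A X)
    {c : ℝ → ℍ} (hc : Tendsto (fun t => (c t : ℂ)) atTop (𝓝 (X 0 : ℂ))) (n : ℕ) :
    Tendsto (fun t => (((prefixIsom A n)⁻¹ (c t) : ℍ) : ℂ)) atTop (𝓝 (X n : ℂ)) := by
  induction n with
  | zero => simpa [prefixIsom] using hc
  | succ n ih =>
    simp_rw [coe_prefixIsom_succ_inv]
    rw [← h.letterMap_invLetter n]
    exact (continuousAt_letterMap _ (h.ne_letterCentre n)).tendsto.comp ih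

theorem IsCoding.norm_prefixIsom_sub_le {A : ℕ → ℕ × Bool} {X : ℕ → ℝ} (h : IsCoding A X) (n : ℕ)
    {w : ℍ} (hw : ‖(w : ℂ) - letterCentre (A n)‖ ≤ radius (A n).1) :
    ‖((prefixIsom A n w : ℍ) : ℂ) - X 0‖ ≤ (16 / 17) ^ n * ‖(w : ℂ) - X n‖ := by
  induction n generalizing w with
  | zero => simp [prefixIsom]
  | succ n ih =>
    have h1 := ih (w := letterIsom (A n) w) (by
      rw [coe_letterIsom]
      exact (norm_letterMap_sub_lt_of_adj (h.adj n) hw).le)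
    refine h1.trans ?_
    rw [pow_succ, mul_assoc, coe_letterIsom, h.eq n, ofReal_realMap]
    gcongr
    refine (norm_letterMap_sub_letterMap_le (h.adj n) (h.adj n) hw (h.norm_lt (n + 1)).le).trans ?_
    gcongr
    exact ratio_le _

/-- The prefixes contract towards the real point `X 0`, so the heights of these orbit points decay
geometrically. -/
theorem IsCoding.im_prefixIsom_I_le {A : ℕ → ℕ × Bool} {X : ℕ → ℝ} (h : IsCoding A X) (n : ℕ) :
    (prefixIsom A (n + 1) I).im ≤ (16 / 17) ^ n := by
  have h1 : ‖((letterIsom (A n) I : ℍ) : ℂ) - letterCentre (A n)‖ ≤ radius (A n).1 := by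
    rw [coe_letterIsom]
    exact (norm_letterMap_I_sub_lt (A n)).le
  have h2 := h.norm_prefixIsom_sub_le n h1
  have h3 := (h.norm_lt n).le
  have h4 : ‖((letterIsom (A n) I : ℍ) : ℂ) - X n‖ ≤ 1 := by
    have h5 := radius_le (A n).1
    have h6 := norm_sub_le (((letterIsom (A n) I : ℍ) : ℂ) - letterCentre (A n))
      ((X n : ℂ) - letterCentre (A n))
    rw [sub_sub_sub_cancel_right] at h6
    linarith
  have h5 : |(((prefixIsom A (n + 1) I : ℍ) : ℂ) - X 0).im| ≤ _ := Complex.abs_im_le_norm _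
  have h6 : (prefixIsom A (n + 1) I).im ≤ |(((prefixIsom A (n + 1) I : ℍ) : ℂ) - X 0).im| := by
    simp [le_abs_self]
  calc _ ≤ _ := h6.trans h5
    _ ≤ _ := h2
    _ ≤ (16 / 17) ^ n * 1 := by gcongr
    _ = _ := mul_one _

/-- A geodesic ray to a point which is coded with infinitely many letters of index less than `k`
returns infinitely often to a neighbourhood of the orbit. -/
theorem IsCoding.eventually_le {A : ℕ → ℕ × Bool} {X : ℕ → ℝ} (h : IsCoding A X) {l : ℕ}
    (hl : 1 ≤ l) (hA : ∀ n, l ≤ (A n).1) {o : ℍ} {c : ℝ → ℍ}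
    (hc : IsGeodesicRay o (X 0 : OnePoint ℝ) c)
    (hinf : Tendsto (fun t => Metric.infDist (c t) (orbit (tailGroup pairingMatrix l) o)) atTop
      atTop) (k : ℕ) : ∀ᶠ n in atTop, k ≤ (A n).1 := by
  -- The bound of `exp_neg_gromovProduct_ge`, made uniform over letters of index below `k`. `K` is
  -- the resulting distance from the ray to the orbit point, with `dist o I` paying for the change
  -- of base point.
  set η := 1 / (24 * (centre k + 2)) with hη
  have hηpos : 0 < η := by have := centre_pos k; positivity
  set K := 4 * Real.exp ((-Real.log η + dist o I) / 2) with hK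
  obtain ⟨T, hT⟩ := eventually_atTop.1 (hinf.eventually_gt_atTop (K + dist o I))
  -- The ray comes near this orbit point, which by transience can happen only before time `T`; so
  -- the orbit point stays in a fixed ball around `o`. For large `n` this contradicts the decay of
  -- its height.
  have hdist (n : ℕ) (hn : (A n).1 < k) : dist o (prefixIsom A (n + 1) I) ≤ K + |T| := by
    have hct := (tendsto_coe_nhdsInfty o (X 0)).comp hc.tendsto
    have h1 := h.tendsto_prefixIsom_inv hct (n + 1)
    have h2 : ∀ᶠ t in atTop, ‖(((prefixIsom A (n + 1))⁻¹ (c t) : ℍ) : ℂ) -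
        letterCentre (A (n + 1))‖ < radius (A (n + 1)).1 :=
      (h1.sub_const _).norm.eventually_lt_const (h.norm_lt (n + 1))
    obtain ⟨s, hs, hs2⟩ := (h2.and (eventually_ge_atTop 2)).exists
    have h3 := exp_neg_gromovProduct_ge (h.adj n) (hl.trans (hA n))
      (norm_prefixIsom_inv_I_sub_lt h.adj n).le hs.le
    rw [← gromovProduct_apply] at h3
    have h4 : η ≤ Real.exp (-gromovProduct (prefixIsom A (n + 1) I) I (c s)) := by
      refine le_trans ?_ h3
      have := centre_pos (A n).1
      have := centre_mono hn.le
      rw [hη]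
      gcongr
    have h5 := (Real.log_le_iff_le_exp hηpos).2 h4
    have h6 := gromovProduct_le_add_dist (prefixIsom A (n + 1) I) o I (c s)
    obtain ⟨t, ht0, ht⟩ := exists_dist_le_of_gromovProduct_le hc.dist_eq
      (prefixIsom A (n + 1) I) hs2 (M := -Real.log η + dist o I) (by rw [hc.start]; linarith)
    rw [dist_comm] at ht
    have h7 : Metric.infDist (c t) (orbit (tailGroup pairingMatrix l) o) ≤ K + dist o I := by
      have hmem : prefixIsom A (n + 1) o ∈ orbit (tailGroup pairingMatrix l) o :=
        ⟨_, prefixIsom_mem_tailGroup hA (n + 1), rfl⟩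
      refine (Metric.infDist_le_dist_of_mem hmem).trans ?_
      have h8 := dist_triangle (c t) (prefixIsom A (n + 1) I) (prefixIsom A (n + 1) o)
      rw [(prefixIsom A (n + 1)).dist_eq, dist_comm I o] at h8
      linarith
    have htT : t < T := by
      by_contra hTt
      exact absurd (hT t (not_lt.1 hTt)) (not_lt.2 h7)
    have h9 := dist_triangle o (c t) (prefixIsom A (n + 1) I)
    have h10 : dist o (c t) = t := by
      rw [← hc.start, hc.dist_eq 0 t le_rfl ht0, zero_sub, abs_neg, abs_of_nonneg ht0]
    rw [h10] at h9
    have := le_abs_self T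
    linarith
  have hlim : Tendsto (fun n : ℕ => (16 / 17 : ℝ) ^ n * Real.exp (K + |T|)) atTop (𝓝 0) := by
    have := (tendsto_pow_atTop_nhds_zero_of_lt_one (r := (16 / 17 : ℝ)) (by norm_num)
      (by norm_num)).mul_const (Real.exp (K + |T|))
    rwa [zero_mul] at this
  filter_upwards [hlim.eventually_lt_const o.im_pos] with n hn
  by_contra hk
  have h1 := UpperHalfPlane.im_le_im_mul_exp_dist o (prefixIsom A (n + 1) I)
  have h2 := hdist n (not_le.1 hk)
  have h3 : (prefixIsom A (n + 1) I).im * Real.exp (dist o (prefixIsom A (n + 1) I)) ≤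
      (16 / 17) ^ n * Real.exp (K + |T|) :=
    mul_le_mul (h.im_prefixIsom_I_le n) (Real.exp_le_exp.2 h2) (Real.exp_pos _).le (by positivity)
  linarith

/-! ### Dimension of the transient limit set -/

theorem hausdorffDim_transientLimitSet_le {k l : ℕ} (hk : 1 ≤ k) (hl : 1 ≤ l) (o : ℍ) :
    hausdorffDim o (transientLimitSet (tailGroup pairingMatrix l) o) ≤ 1 / (2 * (k : ℝ≥0∞)) := by
  refine hausdorffDim_le (T := centreOrbit ∪ ⋃ N, ⋃ a, codedSet k N a) (fun x hx => ?_) ?_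
  · obtain ⟨hx, c, hc, hinf⟩ := hx
    by_cases h : x ∈ centreOrbit
    · exact Or.inl h
    · obtain ⟨A, X, hAX, rfl, hA⟩ := exists_isCoding (mem_closure_coe_orbit_of_mem_closure I
        (mem_closure_coe_orbit_of_mem_limitSet hx)) h
      obtain ⟨N, hN⟩ := eventually_atTop.1 (hAX.eventually_le hl hA hc hinf k)
      exact Or.inr (Set.mem_iUnion₂.2 ⟨N, A 0, A, X, hAX, rfl, rfl, hN⟩)
  · rw [dimH_union, dimH_countable countable_centreOrbit]
    simp_rw [dimH_iUnion]
    exact max_le zero_le (iSup₂_le fun N a => dimH_codedSet_le hk N a)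

theorem hausdorffDim_transientLimitSet_eq_zero {l : ℕ} (hl : 1 ≤ l) (o : ℍ) :
    hausdorffDim o (transientLimitSet (tailGroup pairingMatrix l) o) = 0 := by
  have hlim : Tendsto (fun k : ℕ => 1 / (2 * (k : ℝ≥0∞))) atTop (𝓝 0) := by
    have h := ENNReal.Tendsto.const_mul (a := 2⁻¹) ENNReal.tendsto_inv_nat_nhds_zero
      (Or.inr (by simp))
    rw [mul_zero] at h
    refine h.congr fun k => ?_
    rw [one_div, ENNReal.mul_inv (by simp) (by simp)]
  refine le_antisymm (ge_of_tendsto hlim ?_) zero_le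
  filter_upwards [eventually_ge_atTop 1] with k hk
  exact hausdorffDim_transientLimitSet_le hk hl o

end

end Fuchsian

theorem theorem2 :
    ∃ (Γ : Subgroup (ℍ ≃ᵢ ℍ)) (h : ℕ → SL(2, ℝ)),
      -- the group
      Fuchsian.IsFuchsian Γ ∧
      Fuchsian.IsTorsionFree Γ ∧
      ¬ Γ.FG ∧
      -- its transient limit set, for every choice of the base point
      (∀ o : ℍ, Fuchsian.hausdorffDim o (Fuchsian.transientLimitSet Γ o) = 0) ∧
      -- its construction
      (∀ j : ℕ, 1 ≤ j → Fuchsian.PairsHalfCircles j (h j)) ∧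
      Γ = Fuchsian.tailGroup h 1 ∧
      -- the limit sets of the subgroups generated by `h k, h (k + 1), …`
      (∀ k : ℕ, 1 ≤ k → ∀ o : ℍ,
        Fuchsian.hausdorffDim o (Fuchsian.limitSet (Fuchsian.tailGroup h k) o)
          ≤ 1 / (2 * (k : ℝ≥0∞))) :=
  ⟨Fuchsian.tailGroup Fuchsian.pairingMatrix 1, Fuchsian.pairingMatrix,
    Fuchsian.isFuchsian_tailGroup 1, Fuchsian.isTorsionFree_tailGroup 1,
    Fuchsian.not_fg_tailGroup 1, Fuchsian.hausdorffDim_transientLimitSet_eq_zero le_rfl,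
    fun j _ => Fuchsian.pairsHalfCircles_pairingMatrix j, rfl,
    fun _ hk o => Fuchsian.hausdorffDim_limitSet_le hk o⟩
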